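/- **Setting.** Let $\{F_P\}$, $F_P:\mathcal K_P\times\tilde{\mathcal D}_P\to\mathcal D'_P$ (finite sets), be an indexed collection of efficiently computable keyed functions: a probabilistic polynomial-time instance generator $\mathcal{IG}$ on input $1^n$ outputs a parameterization $P$; $\mathcal P_n$ is the set of its possible outputs; given $P\in\mathcal P_n$ one can, in time $\mathrm{poly}(n)$, recover $n$, sample (up to negligible error) a uniform key $k\in\mathcal K_P$, and evaluate $F_P(k,x)$. The collection is a *classical-secure pseudorandom function collection* if for every classical probabilistic polynomial-time adversary $\mathcal A$, every polynomial $p$ and all sufficiently large $n$, $$\Big|\Pr_{P\leftarrow\mathcal{IG}(1^n),\,k\leftarrow U(\mathcal K_P)}[\mathcal A^{F_P(k,\cdot)}(P)=1]-\Pr_{P\leftarrow\mathcal{IG}(1^n),\,R\leftarrow U(\tilde{\mathcal D}_P\to\mathcal D'_P)}[\mathcal A^{R}(P)=1]\Big|<\frac1{p(n)},$$ where $\mathcal A$ has membership-query access to the indicated function. For a distribution $D$ over $\{0,1\}^\ell$ a $(d_{\mathrm{KL}},\epsilon)$ *generator* is an efficient classical randomized algorithm whose output distribution $D'$ over $\{0,1\}^\ell$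 satisfies $d_{\mathrm{KL}}(D,D')=\sum_x D(x)\log_2\frac{D(x)}{D'(x)}\le\epsilon$ (with $d_{\mathrm{KL}}=\infty$ if $D'(x)=0<D(x)$ for some $x$). An *efficient classical $(\epsilon,\delta,\mathrm{SAMPLE},d_{\mathrm{KL}})$ PAC generator learner* for a class $\mathcal C_n$ of distributions is a classical probabilistic algorithm which on input $1^n$, for every $D\in\mathcal C_n$, given access to independent samples from $D$, always halts in time $\mathrm{poly}(n)$ and with probability at least $1-\delta$ outputs a $(d_{\mathrm{KL}},\epsilon)$ generator for $D$ running in time $\mathrm{poly}(n)$. Generators are output as bit strings $h$, standing for the algorithm $G(1^n,h)$, where the polynomial-time evaluator $G$ is an arbitrary part of the learner. **Statement.** Let $\{F_P\}$ be a classical-secure pseudorandom function collection such that for all $n\ge1$ and all $P\in\mathcal P_n$: $\tilde{\mathcal D}_P=\{0,1\}^n$; $\mathcal D'_P$ is a set of non-negative integers with $n$-bit binary representations $\mathrm{BIN}_n$; and $|\mathcal D'_P|\ge2$. Assume that the $P\in\mathcal P_n$ have an efficiently computable, injective encoding $\mathrm{BIN}_m(P)\in\{0,1\}^m$ with $m=m(n)$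 bounded by a polynomial. For $P\in\mathcal P_n$ and $k\in\mathcal K_P$ let $D_{(P,k)}$ be the distribution over $\{0,1\}^{2n+m}$ of $$\mathsf{GEN}_{(P,k)}(x)=x\,\|\,\mathrm{BIN}_n(F_P(k,x))\,\|\,\mathrm{BIN}_m(P),\qquad x\leftarrow U(\{0,1\}^n),$$ and let $\mathcal C_n=\{D_{(P,k)}\mid P\in\mathcal P_n,\ k\in\mathcal K_P\}$. Then for all sufficiently large $n$ the class $\mathcal C_n$ is not efficiently classically PAC generator-learnable with respect to $\mathrm{SAMPLE}$ and the KL divergence. That is, it is not the case that for all $\epsilon>0$ and $0<\delta<1$ there is an algorithm which for infinitely many $n$ is an efficient $(\epsilon,\delta,\mathrm{SAMPLE},d_{\mathrm{KL}})$ PAC generator learner for $\mathcal C_n$. In other words, there are $\epsilon>0$ and $0<\delta<1$ such that every efficient algorithm fails to be such a learner for all but finitely many $n$. -/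

import Mathlib

/-!
Concrete complexity-theoretic setting: a machine model with step counting (programs acting on
finitely many bit-string registers, with fair coins and an oracle), keyed function collections,
classical-secure pseudorandom functions, and PAC learning of generators for distributions.
-/

namespace PACGen

open Filter

noncomputable section

/-! ### Bit strings -/

/-- Bit strings. -/
abbrev Str : Type := List Bool

/-- The unary string `1^n`. -/
def unary (n : ℕ) : Str := List.replicate n true

/-- `{0,1}^n`, as a finite set of bit strings. -/
def bitStrings (n : ℕ) : Finset Str :=
  (Finset.univ : Finset (Fin n → Bool)).image List.ofFn

theorem mem_bitStrings {n : ℕ} {x : Str} : x ∈ bitStrings n ↔ x.length = n := by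
  constructor
  · intro h
    obtain ⟨v, -, rfl⟩ := Finset.mem_image.mp h
    simp
  · rintro rfl
    exact Finset.mem_image.mpr ⟨x.get, Finset.mem_univ _, List.ofFn_get x⟩

theorem bitStrings_nonempty (n : ℕ) : (bitStrings n).Nonempty :=
  ⟨List.replicate n true, mem_bitStrings.mpr (by simp)⟩

/-- The shortest binary representation of a natural number, most significant bit first
(with `BIN 0` the one-bit string `0`). -/
def BIN (x : ℕ) : Str := if x = 0 then [false] else (Nat.bits x).reverse

/-- The `n`-bit binary representation of `x`: `BIN x` padded with leading zeros.  It exists if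
`(BIN x).length ≤ n`. -/
def BINn (n x : ℕ) : Str := (BIN x).leftpad n false

/-! ### Machine model -/

/-- Programs over registers (indexed by `ℕ`; a program mentions finitely many of them), each
holding a bit string. -/
inductive Prog : Type
  /-- do nothing -/
  | skip : Prog
  /-- put the bit `b` in front of register `r` -/
  | push (b : Bool) (r : ℕ) : Prog
  /-- remove the first bit of register `r`, if there is one -/
  | pop (r : ℕ) : Prog
  /-- replace the content of register `j` by that of register `i` -/
  | copy (i j : ℕ) : Prog
  /-- put a fair random bit in front of register `r` -/
  | flip (r : ℕ) : Prog
  /-- submit the content of register `i` to the oracle and store the answer in register `j` -/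
  | query (i j : ℕ) : Prog
  /-- sequential composition -/
  | seq (p q : Prog) : Prog
  /-- run `e`, `p₀` or `p₁` if register `r` is empty, starts with `0`, or starts with `1` -/
  | branch (r : ℕ) (e p₀ p₁ : Prog) : Prog
  /-- repeat `p` as long as register `r` is not empty -/
  | loop (r : ℕ) (p : Prog) : Prog

/-- Contents of all registers. -/
abbrev Store : Type := ℕ → Str

/-- A (possibly probabilistic, memoryless) oracle: each query is answered by a fresh sample of a
distribution depending on the query. -/
abbrev Oracle : Type := Str → PMF Str

/-- The trivial oracle, for algorithms without an oracle. -/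
def noOracle : Oracle := fun _ => PMF.pure []

/-- A configuration: the programs that remain to be executed, and the register contents.  The
machine has halted if no program remains. -/
abbrev Config : Type := List Prog × Store

/-- One step of the computation.  A step lengthens a register by at most one bit beyond the
current maximal register length, except for oracle answers. -/
def step (O : Oracle) : Config → PMF Config
  | ([], s) => PMF.pure ([], s)
  | (Prog.skip :: K, s) => PMF.pure (K, s)
  | (Prog.push b r :: K, s) => PMF.pure (K, Function.update s r (b :: s r))
  | (Prog.pop r :: K, s) => PMF.pure (K, Function.update s r (s r).tail)
  | (Prog.copy i j :: K, s) => PMF.pure (K, Function.update s j (s i))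
  | (Prog.flip r :: K, s) =>
      (PMF.uniformOfFintype Bool).map fun b => (K, Function.update s r (b :: s r))
  | (Prog.query i j :: K, s) => (O (s i)).map fun a => (K, Function.update s j a)
  | (Prog.seq p q :: K, s) => PMF.pure (p :: q :: K, s)
  | (Prog.branch r e p₀ p₁ :: K, s) =>
      match s r with
      | [] => PMF.pure (e :: K, s)
      | false :: _ => PMF.pure (p₀ :: K, s)
      | true :: _ => PMF.pure (p₁ :: K, s)
  | (Prog.loop r p :: K, s) =>
      match s r with
      | [] => PMF.pure (K, s)
      | _ :: _ => PMF.pure (p :: Prog.loop r p :: K, s)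

/-- The distribution of the configuration after `t` steps. -/
def run (O : Oracle) : ℕ → Config → PMF Config
  | 0, c => PMF.pure c
  | t + 1, c => (step O c).bind (run O t)

/-- Inputs are placed in registers `0, 1, …`; all other registers are empty. -/
def load (xs : List Str) : Store := fun i => xs.getD i []

/-- The output, found in register `0`, of a halted configuration. -/
def result : Config → Option Str
  | ([], s) => some (s 0)
  | (_ :: _, _) => none

/-- The distribution of the output of program `p` on inputs `xs` when given `t` steps; `none`
means that the program has not halted within `t` steps. -/
def exec (O : Oracle) (p : Prog) (xs : List Str) (t : ℕ) : PMF (Option Str) :=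
  (run O t ([p], load xs)).map result

/-- The program halts within `t` steps, whatever the coins and the oracle answers are. -/
def HaltsIn (O : Oracle) (p : Prog) (xs : List Str) (t : ℕ) : Prop :=
  none ∉ (exec O p xs t).support

/-- The distribution of the output, to be used for programs that halt within `t` steps. -/
def outDist (O : Oracle) (p : Prog) (xs : List Str) (t : ℕ) : PMF Str :=
  (exec O p xs t).map fun o => o.getD []

/-- Without an oracle, on inputs `xs`, program `p` surely halts within `t` steps with output `y`. -/
def Computes (p : Prog) (xs : List Str) (y : Str) (t : ℕ) : Prop :=
  exec noOracle p xs t = PMF.pure (some y)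

/-- Probability of an event, as a real number. -/
def prob {α : Type} (μ : PMF α) (S : Set α) : ℝ := (μ.toOuterMeasure S).toReal

/-! ### Oracles -/

/-- The membership query oracle of a function `f` on a finite set of strings: a query `x` in the
domain is answered by the binary representation of `f x` (any other query by the empty string). -/
def MQ (X : Finset Str) (f : {x // x ∈ X} → ℕ) : Oracle :=
  fun x => PMF.pure (if h : x ∈ X then BIN (f ⟨x, h⟩) else [])

/-- The sample oracle of a distribution. -/
def SAMPLE (D : PMF Str) : Oracle := fun _ => D

/-! ### Keyed function collections and pseudorandom functions -/

/-- An indexed collection of keyed functions `F_P : 𝒦_P × 𝒟_P → 𝒟'_P` with finite key spaces,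
domains and codomains, together with its instance generation algorithm, which runs in polynomial
time on input `1^n`.  Parameterizations are given as bit strings, which serve also as the
descriptions of `𝒦_P`, `𝒟_P`, `𝒟'_P`.  (Values at strings which are not output by the instance
generation algorithm are irrelevant.) -/
structure KeyedCollection where
  /-- the instance generation algorithm -/
  IG : Prog
  /-- a polynomial bound for its running time -/
  igTime : Polynomial ℕ
  ig_halts : ∀ n : ℕ, HaltsIn noOracle IG [unary n] (igTime.eval n)
  /-- the key spaces -/
  Key : Str → Finset Str
  /-- the domains -/
  Dom : Str → Finset Str
  /-- the codomains -/
  Cod : Str → Finset ℕ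
  /-- the functions -/
  F : Str → Str → Str → ℕ
  key_nonempty : ∀ P, (Key P).Nonempty
  cod_nonempty : ∀ P, (Cod P).Nonempty

namespace KeyedCollection

/-- The distribution of `IG(1^n)`. -/
def igDist (C : KeyedCollection) (n : ℕ) : PMF Str :=
  outDist noOracle C.IG [unary n] (C.igTime.eval n)

/-- `𝒫_n`: the possible outputs of `IG(1^n)`. -/
def params (C : KeyedCollection) (n : ℕ) : Set Str := (C.igDist n).support

/-- The uniform distribution on the key space `𝒦_P`. -/
def keyDist (C : KeyedCollection) (P : Str) : PMF Str :=
  PMF.uniformOfFinset (C.Key P) (C.key_nonempty P)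

/-- The uniform distribution on all functions from `𝒟_P` to `𝒟'_P`. -/
def randomFunction (C : KeyedCollection) (P : Str) :
    PMF ({x // x ∈ C.Dom P} → {y // y ∈ C.Cod P}) :=
  haveI : Nonempty {y // y ∈ C.Cod P} := (C.cod_nonempty P).to_subtype
  PMF.uniformOfFintype _

/-- The collection is an indexed collection of efficiently computable keyed functions. -/
structure IsEfficient (C : KeyedCollection) : Prop where
  /-- `F_P` maps `𝒦_P × 𝒟_P` to `𝒟'_P` -/
  maps_to : ∀ n, ∀ P ∈ C.params n, ∀ k ∈ C.Key P, ∀ x ∈ C.Dom P, C.F P k x ∈ C.Cod P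
  /-- the parameter `n` can be recovered efficiently from `P ∈ 𝒫_n` (in particular, the sets
  `𝒫_n` are pairwise disjoint) -/
  recover : ∃ (p : Prog) (q : Polynomial ℕ), ∀ n, ∀ P ∈ C.params n,
    Computes p [P] (unary n) (q.eval n)
  /-- an efficient algorithm samples from the uniform distribution on `𝒦_P`, up to a negligible
  total variation distance (with fair coins and a bounded running time, a distribution which is
  exactly uniform is possible only if the size of `𝒦_P` is a power of two) -/
  keygen : ∃ (p : Prog) (q : Polynomial ℕ),
    (∀ n, ∀ P ∈ C.params n, HaltsIn noOracle p [P] (q.eval n)) ∧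
    ∀ c : Polynomial ℕ, c ≠ 0 → ∀ᶠ n : ℕ in atTop, ∀ P ∈ C.params n,
      (1 / 2) * ∑' k : Str, |((outDist noOracle p [P] (q.eval n)) k).toReal
        - ((C.keyDist P) k).toReal| < 1 / ((c.eval n : ℕ) : ℝ)
  /-- an efficient algorithm evaluates `F_P(k, x)` -/
  evaluate : ∃ (p : Prog) (q : Polynomial ℕ), ∀ n, ∀ P ∈ C.params n,
    ∀ k ∈ C.Key P, ∀ x ∈ C.Dom P, Computes p [P, k, x] (BIN (C.F P k x)) (q.eval n)

/-- Output distribution of the adversary `A` running for `t` steps on input `P ← IG(1^n)` with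
membership queries to `F_P(k, ·)`, for a uniformly random key `k`. -/
def realGame (C : KeyedCollection) (A : Prog) (n t : ℕ) : PMF (Option Str) :=
  (C.igDist n).bind fun P => (C.keyDist P).bind fun k =>
    exec (MQ (C.Dom P) fun x => C.F P k x) A [P] t

/-- Output distribution of the adversary `A` running for `t` steps on input `P ← IG(1^n)` with
membership queries to a uniformly random function from `𝒟_P` to `𝒟'_P`. -/
def idealGame (C : KeyedCollection) (A : Prog) (n t : ℕ) : PMF (Option Str) :=
  (C.igDist n).bind fun P => (C.randomFunction P).bind fun R =>
    exec (MQ (C.Dom P) fun x => (R x : ℕ)) A [P] t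

/-- The collection is a classical-secure pseudorandom function collection.  A probabilistic
polynomial time adversary is a program `A` with a polynomial `t`; it is stopped after `t(n)`
steps. -/
structure ClassicalSecure (C : KeyedCollection) : Prop where
  efficient : C.IsEfficient
  secure : ∀ (A : Prog) (t p : Polynomial ℕ), p ≠ 0 → ∀ᶠ n : ℕ in atTop,
    |prob (C.realGame A n (t.eval n)) {some [true]}
      - prob (C.idealGame A n (t.eval n)) {some [true]}| < 1 / ((p.eval n : ℕ) : ℝ)

/-- `enc` is an efficient `m(n)`-bit encoding of the parameterizations `P ∈ 𝒫_n`, with `m`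
polynomially bounded. -/
structure IsEfficientEncoding (C : KeyedCollection) (m : ℕ → ℕ) (enc : Str → Str) : Prop where
  poly : ∃ q : Polynomial ℕ, ∀ n, m n ≤ q.eval n
  length_eq : ∀ n, ∀ P ∈ C.params n, (enc P).length = m n
  injOn : ∀ n, Set.InjOn enc (C.params n)
  computable : ∃ (p : Prog) (q : Polynomial ℕ), ∀ n, ∀ P ∈ C.params n,
    Computes p [P] (enc P) (q.eval n)

/-- The generator `GEN_{(P,k)}(x) = x || BIN_n(F_P(k,x)) || BIN_m(P)`. -/
def gen (C : KeyedCollection) (enc : Str → Str) (n : ℕ) (P k x : Str) : Str :=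
  x ++ BINn n (C.F P k x) ++ enc P

/-- The distribution `D_{(P,k)}` of `GEN_{(P,k)}(x)` for `x` uniform in `{0,1}^n`. -/
def genDist (C : KeyedCollection) (enc : Str → Str) (n : ℕ) (P k : Str) : PMF Str :=
  (PMF.uniformOfFinset (bitStrings n) (bitStrings_nonempty n)).map (C.gen enc n P k)

/-- The distribution concept class `𝒞_n = {D_{(P,k)} | P ∈ 𝒫_n, k ∈ 𝒦_P}`. -/
def conceptClass (C : KeyedCollection) (enc : Str → Str) (n : ℕ) : Set (PMF Str) :=
  {D | ∃ P ∈ C.params n, ∃ k ∈ C.Key P, D = C.genDist enc n P k}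

end KeyedCollection

/-! ### PAC learning of generators -/

/-- Kullback-Leibler divergence (base 2) of distributions over `{0,1}^l`; it is `⊤` if some
string has positive probability under `D` and probability zero under `D'`. -/
def klDivergence (l : ℕ) (D D' : PMF Str) : EReal :=
  open Classical in
  if ∀ x ∈ bitStrings l, D' x = 0 → D x = 0 then
    ((∑ x ∈ bitStrings l, (D x).toReal * Real.logb 2 ((D x).toReal / (D' x).toReal) : ℝ) : EReal)
  else ⊤

/-- The probabilistic algorithm `G`, run on the inputs `xs`, halts within `t` steps with an output
in `{0,1}^l`, and is a `(d, ε)` generator for `D`. -/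
def IsApproxGenerator (d : ℕ → PMF Str → PMF Str → EReal) (ε : ℝ) (l : ℕ) (D : PMF Str)
    (G : Prog) (xs : List Str) (t : ℕ) : Prop :=
  HaltsIn noOracle G xs t ∧
  (∀ y ∈ (outDist noOracle G xs t).support, y.length = l) ∧
  d l D (outDist noOracle G xs t) ≤ (ε : EReal)

/-- `A` is an `(ε, δ, O, d)` PAC generator learner, with running time at most `t`, for the class
`𝒞` of distributions over `{0,1}^l`: for every `D ∈ 𝒞`, on input `1^n` and with access to the
oracle `O(D)`, it halts within `t` steps and with probability at least `1 - δ` it outputs a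
description `h` of a `(d, ε)` generator for `D` with running time at most `t`.  The generator
described by `h` is the algorithm `G(1^n, h)`, where the evaluator `G` gives meaning to the
descriptions that `A` uses (circuits, codes of programs, …). -/
def IsLearner (d : ℕ → PMF Str → PMF Str → EReal) (O : PMF Str → Oracle) (ε δ : ℝ) (l : ℕ)
    (𝒞 : Set (PMF Str)) (A G : Prog) (n t : ℕ) : Prop :=
  ∀ D ∈ 𝒞, HaltsIn (O D) A [unary n] t ∧
    1 - δ ≤ prob (exec (O D) A [unary n] t)
      {o | ∃ h : Str, o = some h ∧ IsApproxGenerator d ε l D G [unary n, h] t}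

/-- The classes `𝒞 n` of distributions over `{0,1}^(l n)` are, for infinitely many `n`,
efficiently classically PAC generator-learnable with respect to the oracle `O` and the distance
measure `d`: for all `ε`, `δ` there is a probabilistic polynomial time algorithm which is
an `(ε, δ, O, d)` PAC generator learner for `𝒞 n` for infinitely many `n`. -/
def LearnableInfinitelyOften (d : ℕ → PMF Str → PMF Str → EReal) (O : PMF Str → Oracle)
    (l : ℕ → ℕ) (𝒞 : ℕ → Set (PMF Str)) : Prop :=
  ∀ ε δ : ℝ, 0 < ε → 0 < δ → δ < 1 →
    ∃ (A G : Prog) (t : Polynomial ℕ), ∃ᶠ n : ℕ in atTop,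
      IsLearner d O ε δ (l n) (𝒞 n) A G n (t.eval n)

end

end PACGen

open PACGen

/-!
A learner for the classes `𝒞_n` yields a distinguisher for the function collection.  Given `P` and
membership queries to a function `f`, the distinguisher runs the learner and answers each of its
queries by `x || BIN_n(f(x)) || BIN_m(P)` for a fresh uniform `x`, which it logs.  It runs the
generator described by the result once, and accepts if the output has the form
`x || BIN_n(f(x)) || BIN_m(P)` for an `x` that has not been logged.

* If `f` is uniformly random, its value at an argument that has not been queried is still uniform on
  a set of at least two elements, so that the check succeeds with probability at most `1 / 2`
  (`sum_acc_distinguisher_le`).  In place of lazy sampling, the proof bounds the acceptance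
  probability summed over a set of functions that is closed under changing values outside the log
  (`FreeOutside`); this is an induction on the number of steps, in which a query splits the set
  according to the value at the queried argument.  Nothing is assumed about the behaviour of the
  learner here, because for a random `f` its samples do not come from a distribution in the class.
* If `f = F_P(k, ·)`, the samples are distributed as `D_{(P,k)}`, and with probability at least
  `1 - δ` the learner describes a generator with divergence at most `ε`.  The logarithm in the
  divergence forces such a generator to put weight at least `1 - ε - |log| (n + 1) / 2^n` on correct
  strings outside the log (`le_sum_of_klDivergence_le`), and `le_acc_distinguisher` turns this into
  a lower bound for the acceptance probability after polynomially many steps.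

With `ε = δ = 1 / 8` the difference exceeds `1 / 8` for infinitely many `n`, which contradicts
pseudorandomness.

Programs are analysed through `acc O t c`, the probability that configuration `c` halts with output
`[true]` within `t` steps.  It is monotone in `t`, so that upper bounds may ignore running times and
lower bounds only need bounds on them.  Deterministic fragments are treated by `Exec`, which gives
the resulting store; the learner, the generator and the auxiliary programs run on disjoint sets of
registers, by renaming (`sim`).
-/

namespace PACGen

open scoped ENNReal
open Function (update extend)

/-! ### Expectations and acceptance probabilities -/

section Expect

variable {α β : Type}

/-- The expectation of a nonnegative function under a discrete distribution. -/
noncomputable def expect (μ : PMF α) (g : α → ℝ≥0∞) : ℝ≥0∞ := ∑' a, μ a * g a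

theorem expect_pure (a : α) (g : α → ℝ≥0∞) : expect (PMF.pure a) g = g a := by
  unfold expect
  rw [tsum_eq_single a]
  · simp
  · intro b hb
    simp [PMF.pure_apply, hb]

theorem expect_bind (μ : PMF α) (κ : α → PMF β) (g : β → ℝ≥0∞) :
    expect (μ.bind κ) g = expect μ fun a => expect (κ a) g := by
  simp only [expect, PMF.bind_apply, ← ENNReal.tsum_mul_right, ← ENNReal.tsum_mul_left]
  rw [ENNReal.tsum_comm]
  simp only [mul_assoc]

theorem expect_map (μ : PMF α) (f : α → β) (g : β → ℝ≥0∞) :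
    expect (μ.map f) g = expect μ fun a => g (f a) := by
  rw [← PMF.bind_pure_comp, expect_bind]
  simp [expect_pure]

theorem expect_mono {μ : PMF α} {f g : α → ℝ≥0∞} (h : ∀ a ∈ μ.support, f a ≤ g a) :
    expect μ f ≤ expect μ g := by
  refine ENNReal.tsum_le_tsum fun a => ?_
  by_cases ha : μ a = 0
  · simp [ha]
  · exact mul_le_mul_right (h a ((PMF.mem_support_iff _ _).2 ha)) _

theorem expect_const (μ : PMF α) (c : ℝ≥0∞) : expect μ (fun _ => c) = c := by
  simp [expect, ENNReal.tsum_mul_right]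

theorem expect_le {μ : PMF α} {f : α → ℝ≥0∞} {c : ℝ≥0∞} (h : ∀ a ∈ μ.support, f a ≤ c) :
    expect μ f ≤ c :=
  (expect_mono h).trans_eq (expect_const μ c)

theorem le_expect {μ : PMF α} {f : α → ℝ≥0∞} {c : ℝ≥0∞} (h : ∀ a ∈ μ.support, c ≤ f a) :
    c ≤ expect μ f :=
  (expect_const μ c).symm.trans_le (expect_mono h)

theorem expect_sum {ι : Type} (μ : PMF α) (S : Finset ι) (g : ι → α → ℝ≥0∞) :
    expect μ (fun a => ∑ i ∈ S, g i a) = ∑ i ∈ S, expect μ (g i) := by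
  simp only [expect, Finset.mul_sum]
  exact Summable.tsum_finsetSum fun _ _ => ENNReal.summable

theorem expect_uniformOfFinset {S : Finset α} (hS : S.Nonempty) (g : α → ℝ≥0∞) :
    expect (PMF.uniformOfFinset S hS) g = ∑ a ∈ S, (S.card : ℝ≥0∞)⁻¹ * g a := by
  unfold expect
  rw [tsum_eq_sum (s := S)]
  · exact Finset.sum_congr rfl fun a ha => by
      rw [PMF.uniformOfFinset_apply_of_mem hS ha]
  · intro b hb
    rw [PMF.uniformOfFinset_apply_of_notMem hS hb, zero_mul]

theorem expect_uniformOfFintype [Fintype α] [Nonempty α] (g : α → ℝ≥0∞) :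
    expect (PMF.uniformOfFintype α) g = ∑ a, (Fintype.card α : ℝ≥0∞)⁻¹ * g a := by
  simp [expect, tsum_fintype]

theorem apply_eq_expect (μ : PMF α) (a : α) [DecidableEq α] :
    μ a = expect μ fun b => if b = a then 1 else 0 := by
  unfold expect
  rw [tsum_eq_single a]
  · simp
  · intro b hb
    simp [hb]

end Expect

/-- The probability that a run of length `t` from configuration `c` halts with output `[true]`. -/
noncomputable def acc (O : Oracle) (t : ℕ) (c : Config) : ℝ≥0∞ :=
  expect (run O t c) fun c' => if result c' = some [true] then 1 else 0

theorem acc_succ (O : Oracle) (t : ℕ) (c : Config) :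
    acc O (t + 1) c = expect (step O c) (acc O t) := by
  unfold acc
  rw [run, expect_bind]

theorem run_nil (O : Oracle) (t : ℕ) (s : Store) : run O t ([], s) = PMF.pure ([], s) := by
  induction t with
  | zero => rfl
  | succ t ih => rw [run, step, PMF.pure_bind, ih]

theorem acc_nil (O : Oracle) (t : ℕ) (s : Store) :
    acc O t ([], s) = if s 0 = [true] then 1 else 0 := by
  simp [acc, run_nil, expect_pure, result]

theorem acc_le_succ (O : Oracle) (t : ℕ) (c : Config) : acc O t c ≤ acc O (t + 1) c := by
  induction t generalizing c with
  | zero =>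
    obtain ⟨K, s⟩ := c
    cases K with
    | nil => rw [acc_nil, acc_nil]
    | cons p K => simp [acc, run, expect_pure, result]
  | succ t ih =>
    rw [acc_succ, acc_succ]
    exact expect_mono fun c' _ => ih c'

theorem acc_mono (O : Oracle) {t t' : ℕ} (h : t ≤ t') (c : Config) : acc O t c ≤ acc O t' c :=
  monotone_nat_of_le_succ (fun t => acc_le_succ O t c) h

theorem exec_apply_accept (O : Oracle) (p : Prog) (xs : List Str) (t : ℕ) :
    exec O p xs t (some [true]) = acc O t ([p], load xs) := by
  rw [exec, apply_eq_expect, expect_map, acc]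

/-! ### Deterministic program fragments -/

/-- From store `s`, the fragment `p` surely terminates with store `s'` after at most `B` steps. -/
def Exec (O : Oracle) (p : Prog) (s s' : Store) (B : ℕ) : Prop :=
  ∃ τ ≤ B, ∀ K t, run O (τ + t) (p :: K, s) = run O t (K, s')

theorem Exec.mono {O : Oracle} {p : Prog} {s s' : Store} {B B' : ℕ} (h : Exec O p s s' B)
    (hB : B ≤ B') : Exec O p s s' B' := by
  obtain ⟨τ, hτ, h⟩ := h
  exact ⟨τ, hτ.trans hB, h⟩

theorem Exec.acc_le {O : Oracle} {p : Prog} {s s' : Store} {B : ℕ} (h : Exec O p s s' B)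
    (K : List Prog) (t : ℕ) : acc O t (p :: K, s) ≤ acc O t (K, s') := by
  obtain ⟨τ, -, h⟩ := h
  refine (acc_mono O (Nat.le_add_left t τ) _).trans_eq ?_
  rw [acc, h, acc]

theorem Exec.le_acc {O : Oracle} {p : Prog} {s s' : Store} {B : ℕ} (h : Exec O p s s' B)
    (K : List Prog) (t : ℕ) : acc O t (K, s') ≤ acc O (B + t) (p :: K, s) := by
  obtain ⟨τ, hτ, h⟩ := h
  refine le_trans (le_of_eq ?_) (acc_mono O (Nat.add_le_add_right hτ t) _)
  rw [acc, acc, h]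

theorem Exec.of_step {O : Oracle} {p : Prog} {s s' : Store}
    (h : ∀ K, step O (p :: K, s) = PMF.pure (K, s')) : Exec O p s s' 1 :=
  ⟨1, le_rfl, fun K t => by rw [Nat.add_comm, run, h, PMF.pure_bind]⟩

theorem Exec.of_step_cons {O : Oracle} {p q : Prog} {s s' : Store} {B : ℕ}
    (h : ∀ K, step O (p :: K, s) = PMF.pure (q :: K, s)) (hq : Exec O q s s' B) :
    Exec O p s s' (B + 1) := by
  obtain ⟨τ, hτ, hq⟩ := hq
  refine ⟨τ + 1, by omega, fun K t => ?_⟩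
  rw [Nat.add_right_comm, run, h, PMF.pure_bind, hq]

theorem Exec.of_step_cons_cons {O : Oracle} {p q r : Prog} {s s' s'' : Store} {B B' : ℕ}
    (h : ∀ K, step O (p :: K, s) = PMF.pure (q :: r :: K, s)) (hq : Exec O q s s' B)
    (hr : Exec O r s' s'' B') : Exec O p s s'' (B + B' + 1) := by
  obtain ⟨τ, hτ, hq⟩ := hq
  obtain ⟨τ', hτ', hr⟩ := hr
  refine ⟨τ + τ' + 1, by omega, fun K t => ?_⟩
  rw [Nat.add_right_comm, run, h, PMF.pure_bind, Nat.add_assoc, hq, hr]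

theorem Exec.skip {O : Oracle} {s : Store} : Exec O .skip s s 1 := .of_step fun _ => rfl

theorem Exec.push {O : Oracle} {b : Bool} {r : ℕ} {s : Store} :
    Exec O (.push b r) s (update s r (b :: s r)) 1 := .of_step fun _ => rfl

theorem Exec.pop {O : Oracle} {r : ℕ} {s : Store} :
    Exec O (.pop r) s (update s r (s r).tail) 1 := .of_step fun _ => rfl

theorem Exec.copy {O : Oracle} {i j : ℕ} {s : Store} :
    Exec O (.copy i j) s (update s j (s i)) 1 := .of_step fun _ => rfl

theorem Exec.query {O : Oracle} {i j : ℕ} {s : Store} {a : Str} (h : O (s i) = PMF.pure a) :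
    Exec O (.query i j) s (update s j a) 1 :=
  .of_step fun K => by rw [step, h, PMF.pure_map]

theorem Exec.seq {O : Oracle} {p q : Prog} {s s' s'' : Store} {B B' : ℕ}
    (hp : Exec O p s s' B) (hq : Exec O q s' s'' B') : Exec O (.seq p q) s s'' (B + B' + 1) :=
  .of_step_cons_cons (fun _ => rfl) hp hq

theorem Exec.branch {O : Oracle} {r : ℕ} {e p₀ p₁ : Prog} {s s' : Store} {B : ℕ}
    (he : s r = [] → Exec O e s s' B) (h₀ : ∀ l, s r = false :: l → Exec O p₀ s s' B)
    (h₁ : ∀ l, s r = true :: l → Exec O p₁ s s' B) :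
    Exec O (.branch r e p₀ p₁) s s' (B + 1) := by
  rcases hr : s r with _ | ⟨_ | _, l⟩
  · exact .of_step_cons (fun K => by simp [step, hr]) (he hr)
  · exact .of_step_cons (fun K => by simp [step, hr]) (h₀ l hr)
  · exact .of_step_cons (fun K => by simp [step, hr]) (h₁ l hr)

theorem Exec.loop_nil {O : Oracle} {r : ℕ} {p : Prog} {s : Store} (h : s r = []) :
    Exec O (.loop r p) s s 1 := .of_step fun K => by simp [step, h]

theorem Exec.loop_cons {O : Oracle} {r : ℕ} {p : Prog} {s s' s'' : Store} {B B' : ℕ}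
    (h : s r ≠ []) (hp : Exec O p s s' B) (hl : Exec O (.loop r p) s' s'' B') :
    Exec O (.loop r p) s s'' (B + B' + 1) := by
  obtain ⟨b, l, hr⟩ := List.exists_cons_of_ne_nil h
  exact .of_step_cons_cons (fun K => by simp [step, hr]) hp hl

/-! ### Elementary loops -/

/-- Moves the first bit of register `a` to the front of register `b`; an empty register `a`
counts as starting with `0`. -/
def moveBit (a b : ℕ) : Prog :=
  .branch a (.push false b) (.seq (.push false b) (.pop a)) (.seq (.push true b) (.pop a))

/-- Empties register `a` bit by bit onto the front of register `b`, reversing its content. -/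
def moveAll (a b : ℕ) : Prog := .loop a (moveBit a b)

/-- Moves as many bits from register `a` to register `b` as register `t` has. -/
def moveCount (t a b : ℕ) : Prog := .loop t (.seq (.pop t) (moveBit a b))

/-- Shortens register `b` by the length of register `a`. -/
def dropCount (a b : ℕ) : Prog := .loop a (.seq (.pop a) (.pop b))

/-- Pushes as many zeros to register `b` as register `a` has bits. -/
def pushZeros (a b : ℕ) : Prog := .loop a (.seq (.pop a) (.push false b))

/-- Pushes a bit to register `d` for each position at which register `a` differs from register `b`,
so that `d` stays empty if `a` holds a prefix of the content of `b`. -/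
def testPrefix (a b d : ℕ) : Prog :=
  .loop a (.seq
    (.branch a .skip
      (.branch b (.push true d) .skip (.push true d))
      (.branch b (.push true d) (.push true d) .skip))
    (.seq (.pop a) (.pop b)))

/-- Puts as many fair coin flips in front of register `b` as register `a` has bits. -/
def flipCount (a b : ℕ) : Prog := .loop a (.seq (.pop a) (.flip b))

theorem Exec.to {O : Oracle} {p : Prog} {s s' s'' : Store} {B B' : ℕ} (h : Exec O p s s' B)
    (hs : s' = s'') (hB : B ≤ B') : Exec O p s s'' B' :=
  hs ▸ h.mono hB

theorem Exec.moveBit {O : Oracle} {a b : ℕ} (hab : a ≠ b) {s : Store} :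
    Exec O (moveBit a b) s
      (update (update s b ((s a).headD false :: s b)) a (s a).tail) 4 := by
  refine Exec.branch (B := 3) (fun h => ?_) (fun l h => ?_) (fun l h => ?_)
  · refine Exec.push.to ?_ (by norm_num)
    funext r
    simp only [Function.update_apply]
    split_ifs <;> simp_all
  all_goals
    refine (Exec.seq Exec.push Exec.pop).to ?_ le_rfl
    funext r
    simp only [Function.update_apply]
    split_ifs <;> simp_all

theorem Exec.moveAll {O : Oracle} {a b : ℕ} (hab : a ≠ b) {l : Str} {s : Store} (h : s a = l) :
    Exec O (moveAll a b) s (update (update s b (l.reverse ++ s b)) a []) (5 * l.length + 1) := by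
  induction l generalizing s with
  | nil =>
    refine (Exec.loop_nil h).to ?_ (by simp)
    funext r
    simp only [Function.update_apply]
    split_ifs <;> simp_all
  | cons x l ih =>
    refine (Exec.loop_cons (by simp [h]) (Exec.moveBit hab) (ih ?_)).to ?_ ?_
    · simp [h]
    · funext r
      simp only [Function.update_apply]
      split_ifs <;> simp_all
    · simp only [List.length_cons]
      omega

theorem Exec.moveCount {O : Oracle} {t a b : ℕ} (hta : t ≠ a) (htb : t ≠ b) (hab : a ≠ b) {n : ℕ}
    {s : Store} (h : (s t).length = n) :
    Exec O (moveCount t a b) s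
      (update (update (update s b (((s a).takeD n false).reverse ++ s b)) a ((s a).drop n)) t [])
      (7 * n + 1) := by
  induction n generalizing s with
  | zero =>
    have h' := List.length_eq_zero_iff.1 h
    refine (Exec.loop_nil h').to ?_ (by simp)
    funext r
    simp only [Function.update_apply]
    split_ifs <;> simp_all
  | succ n ih =>
    have h' : s t ≠ [] := by
      intro h'
      simp [h'] at h
    refine (Exec.loop_cons h' (Exec.seq Exec.pop (Exec.moveBit hab)) (ih ?_)).to ?_ ?_
    · simp [Function.update_apply, hta, htb, h]
    · funext r
      simp only [Function.update_apply]
      split_ifs <;> simp_all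
    · omega

theorem Exec.dropCount {O : Oracle} {a b : ℕ} (hab : a ≠ b) {l : Str} {s : Store} (h : s a = l) :
    Exec O (dropCount a b) s (update (update s b ((s b).drop l.length)) a [])
      (4 * l.length + 1) := by
  induction l generalizing s with
  | nil =>
    refine (Exec.loop_nil h).to ?_ (by simp)
    funext r
    simp only [Function.update_apply]
    split_ifs <;> simp_all
  | cons x l ih =>
    refine (Exec.loop_cons (by simp [h]) (Exec.seq Exec.pop Exec.pop) (ih ?_)).to ?_ ?_
    · simp [h, hab]
    · funext r
      simp only [Function.update_apply]
      split_ifs <;> simp_all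
    · simp only [List.length_cons]
      omega

theorem Exec.pushZeros {O : Oracle} {a b : ℕ} (hab : a ≠ b) {l : Str} {s : Store} (h : s a = l) :
    Exec O (pushZeros a b) s (update (update s b (List.replicate l.length false ++ s b)) a [])
      (4 * l.length + 1) := by
  induction l generalizing s with
  | nil =>
    refine (Exec.loop_nil h).to ?_ (by simp)
    funext r
    simp only [Function.update_apply]
    split_ifs <;> simp_all
  | cons x l ih =>
    refine (Exec.loop_cons (by simp [h]) (Exec.seq Exec.pop Exec.push) (ih ?_)).to ?_ ?_
    · simp [h, hab]
    · funext r
      simp only [Function.update_apply]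
      split_ifs <;> simp_all [List.replicate_succ']
    · simp only [List.length_cons]
      omega

/-- The registers `a` and `b` are consumed; only the emptiness of `d` and the remaining registers
matter afterwards. -/
theorem Exec.testPrefix {O : Oracle} {a b d : ℕ} (hab : a ≠ b) (had : a ≠ d) (hbd : b ≠ d)
    {l : Str} {s : Store} (h : s a = l) :
    ∃ s', Exec O (testPrefix a b d) s s' (9 * l.length + 1) ∧
      (s' d = [] ↔ s d = [] ∧ l <+: s b) ∧ ∀ r, r ≠ a → r ≠ b → r ≠ d → s' r = s r := by
  induction l generalizing s with
  | nil => exact ⟨s, (Exec.loop_nil h).mono (by simp), by simp, fun r _ _ _ => rfl⟩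
  | cons x l ih =>
    -- the store after one pass through the loop
    let s₁ := update (update (if (s b).head? = some x then s else update s d (true :: s d)) a l)
      b (s b).tail
    have hs₁ : s₁ a = l := by simp [s₁, hab]
    obtain ⟨s', hs', hd, hr⟩ := ih hs₁
    refine ⟨s', (Exec.loop_cons (B := 7) (by simp [h]) ?_ hs').mono ?_, ?_, fun r ha hb hd => ?_⟩
    · refine (Exec.seq (B := 3) (s' := if (s b).head? = some x then s else
        update s d (true :: s d)) ?_ (Exec.seq Exec.pop Exec.pop)).to ?_ le_rfl
      · refine Exec.branch (B := 2) (fun h => ?_) (fun l h => ?_) (fun l h => ?_)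
        · simp_all
        all_goals
          refine Exec.branch (B := 1) (fun h' => ?_) (fun l h' => ?_) (fun l h' => ?_)
          all_goals
            simp_all
            first | exact Exec.skip | exact Exec.push
      · funext r
        simp only [s₁, Function.update_apply]
        split_ifs <;> simp_all
    · simp only [List.length_cons]
      omega
    · rw [hd]
      rcases hsb : s b with _ | ⟨y, l'⟩
      · simp [s₁, hsb, had.symm, hbd.symm]
      · by_cases hxy : y = x
        · subst hxy
          simp [s₁, hsb, had.symm, hbd.symm, List.cons_prefix_cons]
        · simp [s₁, hsb, had.symm, hbd.symm, List.cons_prefix_cons, hxy, Ne.symm hxy]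
    · rw [hr r ha hb hd]
      simp only [s₁]
      split_ifs <;> simp [ha, hb, hd]

/-! ### Uniform sampling -/

theorem bitStrings_zero : bitStrings 0 = {[]} := by
  ext x
  simp [mem_bitStrings]

theorem card_bitStrings (n : ℕ) : (bitStrings n).card = 2 ^ n := by
  rw [bitStrings, Finset.card_image_of_injective _ List.ofFn_injective]
  simp

theorem sum_bitStrings_succ {M : Type} [AddCommMonoid M] (n : ℕ) (g : Str → M) :
    ∑ x ∈ bitStrings (n + 1), g x
      = ∑ x ∈ bitStrings n, (g (x ++ [true]) + g (x ++ [false])) := by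
  have h : bitStrings (n + 1)
      = (bitStrings n ×ˢ (Finset.univ : Finset Bool)).image fun z => z.1 ++ [z.2] := by
    ext x
    simp only [mem_bitStrings, Finset.mem_image, Finset.mem_product, Finset.mem_univ, and_true,
      Prod.exists]
    constructor
    · intro hx
      have hx' : x ≠ [] := by
        rintro rfl
        simp at hx
      exact ⟨x.dropLast, x.getLast hx', by simp [hx], List.dropLast_append_getLast hx'⟩
    · rintro ⟨y, b, hy, rfl⟩
      simp [hy]
  rw [h, Finset.sum_image, Finset.sum_product]
  · simp
  · rintro ⟨x, b⟩ - ⟨y, c⟩ - hxy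
    simpa using hxy

theorem acc_flipCount {O : Oracle} {a b : ℕ} (hab : a ≠ b) (K : List Prog) (t n : ℕ) {s : Store}
    (h : (s a).length = n) :
    acc O (4 * n + 1 + t) (flipCount a b :: K, s)
      = ∑ x ∈ bitStrings n, (2⁻¹ : ℝ≥0∞) ^ n *
          acc O t (K, update (update s b (x ++ s b)) a []) := by
  induction n generalizing s with
  | zero =>
    have h' := List.length_eq_zero_iff.1 h
    have hs : update (update s b (s b)) a [] = s := by
      simp [← h']
    rw [bitStrings_zero, Finset.sum_singleton, pow_zero, one_mul, Nat.mul_zero, Nat.zero_add,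
      Nat.add_comm, acc_succ, List.nil_append, hs]
    simp [flipCount, step, h', expect_pure]
  | succ n ih =>
    obtain ⟨y, l, hl⟩ : ∃ y l, s a = y :: l := by
      cases hs : s a with
      | nil => simp [hs] at h
      | cons y l => exact ⟨y, l, rfl⟩
    have hl' : l.length = n := by simpa [hl] using h
    have key (x : Bool) := ih (s := update (update s a l) b (x :: s b)) (by simp [hab, hl'])
    rw [sum_bitStrings_succ,
      show 4 * (n + 1) + 1 + t = 4 * n + 1 + t + 1 + 1 + 1 + 1 by ring, acc_succ]
    simp only [flipCount, step, hl, expect_pure]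
    rw [acc_succ]
    simp only [step, expect_pure]
    rw [acc_succ]
    simp only [step, expect_pure, hl, List.tail_cons]
    rw [acc_succ]
    simp only [step, expect_map, expect_uniformOfFintype, Fintype.card_bool, Fintype.sum_bool,
      Function.update_of_ne hab.symm]
    simp only [flipCount] at key
    rw [key, key, Finset.mul_sum, Finset.mul_sum, ← Finset.sum_add_distrib]
    refine Finset.sum_congr rfl fun x _ => ?_
    have hs (c : Bool) :
        update (update (update (update s a l) b (c :: s b)) b
          (x ++ update (update s a l) b (c :: s b) b)) a []
        = update (update s b (x ++ [c] ++ s b)) a [] := by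
      funext r
      simp only [Function.update_apply]
      split_ifs <;> simp_all
    rw [hs, hs, pow_succ]
    push_cast
    ring

/-! ### Simulation of programs on renamed registers -/

/-- The program `p` with its registers renamed by `f`, and `query i j` replaced by `q i j`. -/
def sim (f : ℕ → ℕ) (q : ℕ → ℕ → Prog) : Prog → Prog
  | .skip => .skip
  | .push b r => .push b (f r)
  | .pop r => .pop (f r)
  | .copy i j => .copy (f i) (f j)
  | .flip r => .flip (f r)
  | .query i j => q i j
  | .seq p p' => .seq (sim f q p) (sim f q p')
  | .branch r e p₀ p₁ => .branch (f r) (sim f q e) (sim f q p₀) (sim f q p₁)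
  | .loop r p => .loop (f r) (sim f q p)

/-- Replaces queries by what `noOracle` does, using a register `e` that is always empty. -/
def offline (f : ℕ → ℕ) (e : ℕ) : Prog → Prog := sim f fun _ j => .copy e (f j)

section Sim

variable {f : ℕ → ℕ}

theorem extend_update_comp (hf : f.Injective) (s : Store) (i : ℕ) (v : Str) :
    extend f (update (s ∘ f) i v) s = update s (f i) v := by
  funext r
  by_cases hr : ∃ j, f j = r
  · obtain ⟨j, rfl⟩ := hr
    simp [hf.extend_apply, Function.update_apply, hf.eq_iff]
  · rw [Function.extend_apply' _ _ _ hr, Function.update_of_ne]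
    rintro rfl
    exact hr ⟨i, rfl⟩

theorem extend_comp_self (hf : f.Injective) (s : Store) : extend f (s ∘ f) s = s := by
  funext r
  by_cases hr : ∃ j, f j = r
  · obtain ⟨j, rfl⟩ := hr
    simp [hf.extend_apply]
  · rw [Function.extend_apply' _ _ _ hr]

/-- One step of a simulated program, if it is not a query or a query with the answer `noOracle`
gives. -/
theorem acc_sim_cons (hf : f.Injective) (q : ℕ → ℕ → Prog) (O O' : Oracle) (t : ℕ) (p : Prog)
    (K' K : List Prog) (s : Store)
    (hp : ∀ i j, p = .query i j → O' (s (f i)) = PMF.pure [] ∧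
      ∃ e, s e = [] ∧ q i j = .copy e (f j)) :
    acc O (t + 1) ((p :: K').map (sim f q) ++ K, s)
      = expect (step O' (p :: K', s ∘ f)) fun c =>
          acc O t (c.1.map (sim f q) ++ K, extend f c.2 s) := by
  rw [acc_succ]
  have hs := extend_comp_self hf s
  have hu := extend_update_comp hf s
  cases p with
  | query i j =>
    obtain ⟨h, e, he, hq⟩ := hp i j rfl
    simp only [List.map_cons, List.cons_append, sim, hq, step, Function.comp_apply, h, he,
      PMF.pure_map, expect_pure, hu]
  | flip r =>
    simp only [List.map_cons, List.cons_append, sim, step, expect_map, hu, Function.comp_apply]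
  | branch r e p₀ p₁ =>
    rcases hr : s (f r) with _ | ⟨_ | _, l⟩ <;>
    simp only [List.map_cons, List.cons_append, sim, step, Function.comp_apply, hr, expect_pure, hs]
  | loop r p =>
    rcases hr : s (f r) with _ | ⟨b, l⟩ <;>
    simp only [List.map_cons, List.cons_append, sim, step, Function.comp_apply, hr, expect_pure, hs]
  | _ => simp only [List.map_cons, List.cons_append, sim, step, expect_pure, hs, hu,
      Function.comp_apply]

theorem acc_offline_cons (hf : f.Injective) {e : ℕ} (O : Oracle) (t : ℕ)
    (p : Prog) (K' K : List Prog) (s : Store) (hs : s e = []) :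
    acc O (t + 1) ((p :: K').map (offline f e) ++ K, s)
      = expect (step noOracle (p :: K', s ∘ f)) fun c =>
          acc O t (c.1.map (offline f e) ++ K, extend f c.2 s) :=
  acc_sim_cons hf _ O noOracle t p K' K s fun _ _ _ => ⟨rfl, e, hs, rfl⟩

theorem extend_off (s₀ s : Store) {r : ℕ} (hr : r ∉ Set.range f) : extend f s₀ s r = s r :=
  Function.extend_apply' _ _ _ hr

/-- If `W` bounds from below the acceptance probability of the continuation, then its expectation
after the simulated run does so for the whole. -/
theorem le_acc_offline (hf : f.Injective) {e : ℕ} (he : e ∉ Set.range f) (O : Oracle)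
    (W : Store → ℝ≥0∞) (t : ℕ) (K : List Prog) (T : ℕ) (K' : List Prog) (s : Store)
    (hs : s e = [])
    (h : ∀ s', (∀ r ∉ Set.range f, s' r = s r) → W (s' ∘ f) ≤ acc O t (K, s')) :
    expect (run noOracle T (K', s ∘ f)) (fun c => if c.1 = [] then W c.2 else 0)
      ≤ acc O (T + t) (K'.map (offline f e) ++ K, s) := by
  induction T generalizing K' s with
  | zero =>
    cases K' with
    | nil => simpa [run, expect_pure] using h s fun _ _ => rfl
    | cons p K' => simp [run, expect_pure]
  | succ T ih =>
    cases K' with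
    | nil =>
      rw [run_nil, expect_pure, if_pos rfl]
      exact (h s fun _ _ => rfl).trans (acc_mono O (Nat.le_add_left _ _) _)
    | cons p K' =>
      rw [Nat.add_right_comm, acc_offline_cons hf O _ p K' K s hs, run, expect_bind]
      refine expect_mono fun c _ => ?_
      have := ih c.1 (extend f c.2 s) (by rw [extend_off _ _ he, hs]) fun s' hs' =>
        h s' fun r hr => by rw [hs' r hr, extend_off _ _ hr]
      rwa [Function.extend_comp hf] at this

variable {ι : Type} {S : Finset ι} {O : ι → Oracle}

theorem sum_acc_offline_cons_le (hf : f.Injective) {e : ℕ} (v : ℝ≥0∞) (t : ℕ) (p : Prog)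
    (K' K : List Prog) (s : Store) (hs : s e = [])
    (h : ∀ c ∈ (step noOracle (p :: K', s ∘ f)).support,
      ∑ i ∈ S, acc (O i) t (c.1.map (offline f e) ++ K, extend f c.2 s) ≤ v) :
    ∑ i ∈ S, acc (O i) (t + 1) ((p :: K').map (offline f e) ++ K, s) ≤ v := by
  rw [Finset.sum_congr rfl fun i _ => acc_offline_cons hf (O i) t p K' K s hs, ← expect_sum]
  exact expect_le h

theorem sum_acc_offline_le (hf : f.Injective) {e : ℕ} (he : e ∉ Set.range f) (v : ℝ≥0∞)
    (K : List Prog) (t : ℕ) (K' : List Prog) (s : Store) (hs : s e = [])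
    (h : ∀ s' t', (∀ r ∉ Set.range f, s' r = s r) → ∑ i ∈ S, acc (O i) t' (K, s') ≤ v) :
    ∑ i ∈ S, acc (O i) t (K'.map (offline f e) ++ K, s) ≤ v := by
  induction t generalizing K' s with
  | zero =>
    cases K' with
    | nil => exact h s 0 fun _ _ => rfl
    | cons p K' => simp [acc, run, expect_pure, result]
  | succ t ih =>
    cases K' with
    | nil => exact h s (t + 1) fun _ _ => rfl
    | cons p K' =>
      refine sum_acc_offline_cons_le hf v t p K' K s hs fun c _ => ?_
      exact ih c.1 (extend f c.2 s) (by rw [extend_off _ _ he, hs]) fun s' t' hs' =>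
        h s' t' fun r hr => by rw [hs' r hr, extend_off _ _ hr]

/-- The bound `v` only has to hold for continuations that start with the output `y` of the simulated
program, if that output is certain. -/
theorem sum_acc_offline_le_of_result (hf : f.Injective) {e : ℕ} (he : e ∉ Set.range f) (v : ℝ≥0∞)
    (K : List Prog) (y : Str) (t T : ℕ) (K' : List Prog) (s : Store) (hs : s e = [])
    (hT : ∀ c ∈ (run noOracle T (K', s ∘ f)).support, result c = some y)
    (h : ∀ s' t', (∀ r ∉ Set.range f, s' r = s r) → s' (f 0) = y →
      ∑ i ∈ S, acc (O i) t' (K, s') ≤ v) :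
    ∑ i ∈ S, acc (O i) (T + t) (K'.map (offline f e) ++ K, s) ≤ v := by
  induction T generalizing K' s with
  | zero =>
    cases K' with
    | nil => exact h s _ (fun _ _ => rfl) (by simpa [run, result] using hT)
    | cons p K' => simp [run, result] at hT
  | succ T ih =>
    cases K' with
    | nil => exact h s _ (fun _ _ => rfl) (by simpa [run_nil, result] using hT)
    | cons p K' =>
      rw [Nat.add_right_comm]
      refine sum_acc_offline_cons_le hf v (T + t) p K' K s hs fun c hc => ?_
      refine ih c.1 (extend f c.2 s) (by rw [extend_off _ _ he, hs]) (fun c' hc' => ?_)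
        fun s' t' hs' => h s' t' fun r hr => by rw [hs' r hr, extend_off _ _ hr]
      rw [Function.extend_comp hf] at hc'
      exact hT c' (by rw [run, PMF.mem_support_bind_iff]; exact ⟨c, hc, hc'⟩)

theorem result_of_computes {p : Prog} {xs : List Str} {y : Str} {T : ℕ} (h : Computes p xs y T) :
    ∀ c ∈ (run noOracle T ([p], load xs)).support, result c = some y := by
  intro c hc
  have : result c ∈ (exec noOracle p xs T).support := by
    rw [exec, PMF.mem_support_map_iff]
    exact ⟨c, hc, rfl⟩
  rw [h] at this
  simpa using this

theorem sum_acc_offline_le_of_computes (hf : f.Injective) {e : ℕ} (he : e ∉ Set.range f)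
    (v : ℝ≥0∞) (K : List Prog) {p : Prog} {xs : List Str} {y : Str} {T : ℕ}
    (hp : Computes p xs y T) (t : ℕ) (s : Store) (hs : s e = []) (hxs : s ∘ f = load xs)
    (h : ∀ s' t', (∀ r ∉ Set.range f, s' r = s r) → s' (f 0) = y →
      ∑ i ∈ S, acc (O i) t' (K, s') ≤ v) :
    ∑ i ∈ S, acc (O i) t (offline f e p :: K, s) ≤ v :=
  (Finset.sum_le_sum fun i _ => acc_mono (O i) (Nat.le_add_left t T) _).trans
    (sum_acc_offline_le_of_result hf he v K y t T [p] s hs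
      (by rw [hxs]; exact result_of_computes hp) h)

theorem le_acc_offline_of_computes (hf : f.Injective) {e : ℕ} (he : e ∉ Set.range f)
    (O : Oracle) (v : ℝ≥0∞) (K : List Prog) {p : Prog} {xs : List Str} {y : Str} {T : ℕ}
    (hp : Computes p xs y T) (t : ℕ) (s : Store) (hs : s e = []) (hxs : s ∘ f = load xs)
    (h : ∀ s', (∀ r ∉ Set.range f, s' r = s r) → s' (f 0) = y → v ≤ acc O t (K, s')) :
    v ≤ acc O (T + t) (offline f e p :: K, s) := by
  refine le_trans ?_ (le_acc_offline hf he O (fun s₀ => if s₀ 0 = y then v else 0) t K T [p] s hs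
    fun s' hs' => ?_)
  · refine le_expect fun c hc => ?_
    rw [hxs] at hc
    have := result_of_computes hp c hc
    obtain ⟨_ | _, s₀⟩ := c <;> simp_all [result]
  · simp only [Function.comp_apply]
    split_ifs with hy
    · exact h s' hs' hy
    · exact zero_le

end Sim

/-! ### The programs of the distinguisher -/

/-- Sequential composition of a list of programs. -/
def block : List Prog → Prog
  | [] => .skip
  | p :: l => .seq p (block l)

theorem Exec.block_nil {O : Oracle} {s : Store} : Exec O (block []) s s 1 := Exec.skip

theorem Exec.block_cons {O : Oracle} {p : Prog} {l : List Prog} {s s' s'' : Store} {B B' : ℕ}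
    (hp : Exec O p s s' B) (hl : Exec O (block l) s' s'' B') :
    Exec O (block (p :: l)) s s'' (B + B' + 1) := hp.seq hl

theorem acc_seq (O : Oracle) (p q : Prog) (K : List Prog) (t : ℕ) (s : Store) :
    acc O (t + 1) (.seq p q :: K, s) = acc O t (p :: q :: K, s) := by
  rw [acc_succ, step, expect_pure]

theorem acc_seq_le (O : Oracle) (p q : Prog) (K : List Prog) (t : ℕ) (s : Store) :
    acc O t (.seq p q :: K, s) ≤ acc O t (p :: q :: K, s) :=
  (acc_le_succ O t _).trans_eq (acc_seq O p q K t s)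

/-- The registers of the distinguisher are arranged in five tracks: track `0` is for bookkeeping,
and the four simulated programs use one of the other tracks each. -/
def track (c i : ℕ) : ℕ := 5 * i + c

theorem track_injective (c : ℕ) : (track c).Injective := fun i j h => by
  unfold track at h
  omega

theorem mod_of_mem_range_track {c r : ℕ} (hc : c < 5) (hr : r ∈ Set.range (track c)) :
    r % 5 = c := by
  obtain ⟨i, rfl⟩ := hr
  unfold track
  omega

theorem notMem_range_track {c r : ℕ} (hc : c < 5) (hr : r % 5 ≠ c) : r ∉ Set.range (track c) :=
  fun h => hr (mod_of_mem_range_track hc h)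

/-- the security parameter, in unary -/
local notation "rN" => 5
/-- the encoded parameterization -/
local notation "rEnc" => 10
/-- the arguments at which the simulated sample oracle has evaluated the function, reversed and
concatenated -/
local notation "rLog" => 15
/-- always empty -/
local notation "rNil" => 20
/-- the argument at which the function is evaluated -/
local notation "rArg" => 25
/-- the value of the function -/
local notation "rVal" => 30
/-- holds reversed strings on their way to another register -/
local notation "rBuf" => 35
/-- a counter in unary -/
local notation "rCnt" => 40
/-- the sample `x || BIN_n(f(x)) || BIN_m(P)` -/
local notation "rSmp" => 45
/-- a copy to be consumed -/
local notation "rTmp" => 50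
/-- the output of the generator -/
local notation "rGen" => 55
/-- nonempty if a logged argument differs from the current one -/
local notation "rDiff" => 60
/-- nonempty if the output of the generator is to be rejected -/
local notation "rBad" => 65

/-- Computes the sample that belongs to the argument `x` in `rArg`. -/
def makeSample : Prog := block
  [.query rArg rVal,
   .copy rN rCnt, .copy rVal rTmp, dropCount rTmp rCnt,
   .copy rEnc rSmp, .copy rNil rBuf, moveAll rVal rBuf, moveAll rBuf rSmp,
   pushZeros rCnt rSmp,
   .copy rArg rTmp, .copy rNil rBuf, moveAll rTmp rBuf, moveAll rBuf rSmp]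

/-- Answers a query to the sample oracle in register `j`. -/
def answer (j : ℕ) : Prog :=
  .seq (block [.copy rNil rArg, .copy rN rCnt])
    (.seq (flipCount rCnt rArg)
      (block [.copy rArg rTmp, moveAll rTmp rLog, makeSample, .copy rSmp j]))

/-- Rejects if the argument in `rArg` has been logged. -/
def testFresh : Prog := .loop rLog (block
  [.copy rNil rBuf, .copy rN rCnt, moveCount rCnt rLog rBuf, .copy rArg rTmp, .copy rNil rDiff,
   testPrefix rTmp rBuf rDiff, .branch rDiff (.push true rBad) .skip .skip])

/-- Accepts if the output of the generator extends a correct pair of a fresh argument and its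
value. -/
def check : Prog := block
  [.copy (track 4 0) rGen,
   .copy rGen rTmp, .copy rNil rBuf, .copy rN rCnt, moveCount rCnt rTmp rBuf,
   .copy rNil rArg, moveAll rBuf rArg,
   .copy rNil rBad, testFresh,
   makeSample, testPrefix rSmp rGen rBad,
   .branch rBad (block [.copy rNil 0, .push true 0]) (.copy rNil 0) (.copy rNil 0)]

/-- Runs the learned generator and checks its output. -/
def judge (G : Prog) : Prog := block
  [.copy rN (track 4 0), .copy (track 3 0) (track 4 1), offline (track 4) rNil G, check]

/-- Runs the learner with simulated samples, and judges the result. -/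
def learn (A G : Prog) : Prog :=
  .seq (.copy (track 2 0) rEnc) <| .seq (.copy rN (track 3 0)) <|
    .seq (sim (track 3) (fun _ j => answer (track 3 j)) A) <| judge G

/-- Encodes the parameterization and goes on with the learner. -/
def encodeLearn (E A G : Prog) : Prog :=
  .seq (.copy (track 1 0) rN) <| .seq (.copy 0 (track 2 0)) <|
    .seq (offline (track 2) rNil E) <| learn A G

/-- The distinguisher: `R` recovers the security parameter and `E` encodes the parameterization; the
learner `A` is run with simulated samples, and one output of the generator that it describes, under
the evaluator `G`, is checked. -/
def distinguisher (R E A G : Prog) : Prog :=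
  .seq (.copy 0 (track 1 0)) <| .seq (offline (track 1) rNil R) <| encodeLearn E A G

/-! ### The effect of the deterministic parts -/

theorem exec_makeSample {n : ℕ} {s : Store} (hN : s rN = unary n) (hNil : s rNil = [])
    (hX : (s rArg).length = n) (a : Str) (ha : a.length ≤ n) :
    ∃ s', (∀ O : Oracle, O (s rArg) = PMF.pure a → Exec O makeSample s s' (30 * n + 40)) ∧
      s' rSmp = s rArg ++ a.leftpad n false ++ s rEnc ∧
      ∀ r, r ≠ rVal → r ≠ rCnt → r ≠ rTmp → r ≠ rBuf → r ≠ rSmp → s' r = s r := by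
  refine ⟨_, fun O hO => Exec.mono (Exec.block_cons (Exec.query hO) <|
      Exec.block_cons Exec.copy <| Exec.block_cons Exec.copy <|
      Exec.block_cons (Exec.dropCount (by decide) (l := a) ?_) <| Exec.block_cons Exec.copy <|
      Exec.block_cons Exec.copy <| Exec.block_cons (Exec.moveAll (by decide) (l := a) ?_) <|
      Exec.block_cons (Exec.moveAll (by decide) (l := a.reverse) ?_) <|
      Exec.block_cons (Exec.pushZeros (by decide) (l := unary (n - a.length)) ?_) <|
      Exec.block_cons Exec.copy <| Exec.block_cons Exec.copy <|
      Exec.block_cons (Exec.moveAll (by decide) (l := s rArg) ?_) <|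
      Exec.block_cons (Exec.moveAll (by decide) (l := (s rArg).reverse) ?_) Exec.block_nil) ?_,
    ?_, ?_⟩
  case refine_7 =>
    simp [hX, unary]
    omega
  case refine_8 => simp [hN, hNil, unary, List.leftpad]
  case refine_9 =>
    intro r h₁ h₂ h₃ h₄ h₅
    simp [h₁, h₂, h₃, h₄, h₅]
  all_goals simp [hN, hNil, unary]

/-- The store after a simulated query depends only on the argument `x` that was drawn and on the
value `a` there, not on the rest of the oracle. -/
theorem answer_spec {n : ℕ} {s : Store} (hN : s rN = unary n) (hNil : s rNil = []) {j : ℕ}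
    (hj : j % 5 = 3) :
    ∃ post : Str → Str → Store,
      (∀ x a, x.length = n → a.length ≤ n →
        post x a j = x ++ a.leftpad n false ++ s rEnc ∧ post x a rLog = x.reverse ++ s rLog ∧
        ∀ r, r ≠ rArg → r ≠ rVal → r ≠ rCnt → r ≠ rTmp → r ≠ rBuf → r ≠ rSmp → r ≠ rLog → r ≠ j →
          post x a r = s r) ∧
      ∀ (O : Oracle) (a : Str → Str),
        (∀ x ∈ bitStrings n, O x = PMF.pure (a x) ∧ (a x).length ≤ n) → ∀ K t,
        acc O (t + 1) (answer j :: K, s)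
          ≤ ∑ x ∈ bitStrings n, (2⁻¹ : ℝ≥0∞) ^ n * acc O t (K, post x (a x)) ∧
        ∑ x ∈ bitStrings n, (2⁻¹ : ℝ≥0∞) ^ n * acc O t (K, post x (a x))
          ≤ acc O (40 * n + 70 + t) (answer j :: K, s) := by
  set s₁ : Store := update (update s rArg []) rCnt (unary n) with hs₁
  set s₂ : Str → Store := fun x => update (update s₁ rArg (x ++ s₁ rArg)) rCnt [] with hs₂
  have hprep (O : Oracle) : Exec O (block [.copy rNil rArg, .copy rN rCnt]) s s₁ 5 :=
    (Exec.block_cons Exec.copy <| Exec.block_cons Exec.copy Exec.block_nil).to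
      (by simp [hs₁, hN, hNil]) (by simp)
  have htail (x a : Str) : ∃ s', x.length = n → a.length ≤ n →
      (∀ O : Oracle, O x = PMF.pure a →
        Exec O (block [.copy rArg rTmp, moveAll rTmp rLog, makeSample, .copy rSmp j]) (s₂ x) s'
          (35 * n + 50)) ∧
      s' j = x ++ a.leftpad n false ++ s rEnc ∧ s' rLog = x.reverse ++ s rLog ∧
        ∀ r, r ≠ rArg → r ≠ rVal → r ≠ rCnt → r ≠ rTmp → r ≠ rBuf → r ≠ rSmp → r ≠ rLog → r ≠ j →
          s' r = s r := by
    by_cases hx : x.length = n ∧ a.length ≤ n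
    swap
    · exact ⟨s, fun h₁ h₂ => absurd ⟨h₁, h₂⟩ hx⟩
    obtain ⟨hx, ha⟩ := hx
    set s₃ : Store := update (update (update (s₂ x) rTmp x) rLog (x.reverse ++ s rLog)) rTmp []
      with hs₃
    obtain ⟨s', he, hsmp, hfr⟩ := exec_makeSample (n := n) (s := s₃)
      (by simp [hs₃, hs₂, hs₁, hN]) (by simp [hs₃, hs₂, hs₁, hNil])
      (by simp [hs₃, hs₂, hs₁, hx]) a ha
    refine ⟨update s' j (s' rSmp), fun _ _ => ⟨fun O hO => ?_, ?_, ?_, ?_⟩⟩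
    · refine (Exec.block_cons Exec.copy <|
        Exec.block_cons ((Exec.moveAll (by decide) (l := x) ?_).to (s'' := s₃) ?_ le_rfl) <|
        Exec.block_cons (he O ?_) <| Exec.block_cons Exec.copy Exec.block_nil).mono ?_
      · simp [hs₂, hs₁]
      · simp [hs₃, hs₂, hs₁]
      · simpa [hs₃, hs₂, hs₁] using hO
      · omega
    · rw [Function.update_self, hsmp]
      simp [hs₃, hs₂, hs₁]
    · rw [Function.update_of_ne (by omega), hfr _ (by decide) (by decide) (by decide) (by decide)
        (by decide)]
      simp [hs₃, hs₂, hs₁]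
    · intro r h₁ h₂ h₃ h₄ h₅ h₆ h₇ h₈
      rw [Function.update_of_ne h₈, hfr r h₂ h₃ h₄ h₅ h₆]
      simp [hs₃, hs₂, hs₁, h₁, h₃, h₄, h₇]
  choose post hpost using htail
  refine ⟨post, fun x a hx ha => (hpost x a hx ha).2, fun O a ha K t => ⟨?_, ?_⟩⟩
  · rw [answer, acc_seq]
    refine ((hprep O).acc_le _ t).trans ((acc_seq_le O _ _ _ t _).trans
      ((acc_mono O (Nat.le_add_left t (4 * n + 1)) _).trans_eq
        (acc_flipCount (by decide) _ t n ?_) |>.trans ?_))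
    · simp [hs₁, unary]
    · refine Finset.sum_le_sum fun x hx => mul_le_mul_right ?_ _
      exact ((hpost x (a x) (mem_bitStrings.1 hx) (ha x hx).2).1 O (ha x hx).1).acc_le K t
  · rw [answer]
    calc _ ≤ ∑ x ∈ bitStrings n, (2⁻¹ : ℝ≥0∞) ^ n * acc O (35 * n + 50 + t)
          (block [.copy rArg rTmp, moveAll rTmp rLog, makeSample, .copy rSmp j] :: K, s₂ x) := by
          refine Finset.sum_le_sum fun x hx => mul_le_mul_right ?_ _
          exact ((hpost x (a x) (mem_bitStrings.1 hx) (ha x hx).2).1 O (ha x hx).1).le_acc K t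
      _ = _ := (acc_flipCount (by decide) _ _ n (by simp [hs₁, unary])).symm
      _ = _ := (acc_seq O _ _ _ _ _).symm
      _ ≤ _ := (hprep O).le_acc _ _
      _ = _ := (acc_seq O _ _ _ _ _).symm
      _ ≤ _ := acc_mono O (by omega) _

/-- The content of the log after the arguments `xs` (latest first) have been used. -/
def logOf (xs : List Str) : Str := (xs.map List.reverse).flatten

theorem exec_testFresh {n : ℕ} (hn : 1 ≤ n) {xs : List Str} (hxs : ∀ x ∈ xs, x.length = n)
    {O : Oracle} {s : Store} (hN : s rN = unary n) (hNil : s rNil = [])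
    (hX : (s rArg).length = n) (hL : s rLog = logOf xs) :
    ∃ s', Exec O testFresh s s' (xs.length * (16 * n + 30) + 1) ∧
      (s' rBad = [] ↔ s rBad = [] ∧ s rArg ∉ xs) ∧
      ∀ r, r ≠ rLog → r ≠ rBuf → r ≠ rCnt → r ≠ rTmp → r ≠ rDiff → r ≠ rBad → s' r = s r := by
  induction xs generalizing s with
  | nil => exact ⟨s, (Exec.loop_nil hL).mono (by simp), by simp, fun r _ _ _ _ _ _ => rfl⟩
  | cons x xs ih =>
    have hx : x.length = n := hxs x (by simp)
    have hL' : s rLog = x.reverse ++ logOf xs := by simp [hL, logOf]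
    set s₁ : Store := update (update (update (update (update s rBuf x) rLog (logOf xs)) rCnt [])
      rTmp (s rArg)) rDiff [] with hs₁
    obtain ⟨s₂, he₂, hd₂, hr₂⟩ := Exec.testPrefix (O := O) (a := rTmp) (b := rBuf) (d := rDiff)
      (by decide) (by decide) (by decide) (s := s₁) rfl
    have hd : s₂ rDiff = [] ↔ s rArg = x := by
      rw [hd₂]
      rw [show s₁ rDiff = [] by simp [hs₁], show s₁ rTmp = s rArg by simp [hs₁],
        show s₁ rBuf = x by simp [hs₁], and_iff_right rfl]
      exact ⟨fun h => h.eq_of_length (by rw [hX, hx]), fun h => by rw [h]⟩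
    set s₃ : Store := if s₂ rDiff = [] then update s₂ rBad (true :: s₂ rBad) else s₂ with hs₃
    have hs₂ (r : ℕ) (h₁ : r ≠ rLog) (h₂ : r ≠ rBuf) (h₃ : r ≠ rCnt) (h₄ : r ≠ rTmp)
        (h₅ : r ≠ rDiff) : s₂ r = s r := by
      rw [hr₂ r h₄ h₂ h₅]
      simp [hs₁, h₁, h₂, h₃, h₄, h₅]
    have hs₃' (r : ℕ) (h₆ : r ≠ rBad) : s₃ r = s₂ r := by
      rw [hs₃]
      split_ifs
      · simp [h₆]
      · rfl
    obtain ⟨s', he, hb, hfr⟩ := ih (fun y hy => hxs y (by simp [hy])) (s := s₃)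
      (by rw [hs₃' _ (by decide), hs₂ _ (by decide) (by decide) (by decide) (by decide)
        (by decide), hN])
      (by rw [hs₃' _ (by decide), hs₂ _ (by decide) (by decide) (by decide) (by decide)
        (by decide), hNil])
      (by rw [hs₃' _ (by decide), hs₂ _ (by decide) (by decide) (by decide) (by decide)
        (by decide), hX])
      (by rw [hs₃' _ (by decide), hr₂ _ (by decide) (by decide) (by decide)]; simp [hs₁])
    refine ⟨s', (Exec.loop_cons (B := 16 * n + 29) ?_ ?_ he).mono ?_, ?_, ?_⟩
    · intro h
      rw [hL'] at h
      simp at h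
      simp [h] at hx
      omega
    · refine (Exec.block_cons Exec.copy <| Exec.block_cons Exec.copy <|
        Exec.block_cons (Exec.moveCount (by decide) (by decide) (by decide) (n := n) ?_) <|
        Exec.block_cons Exec.copy <|
        Exec.block_cons (Exec.copy.to (s'' := s₁) ?_ le_rfl) <| Exec.block_cons he₂ <|
        Exec.block_cons (Exec.branch (B := 1) (s' := s₃) ?_ ?_ ?_) Exec.block_nil).mono ?_
      · simp [hN, unary]
      · have h₁ : (x.reverse ++ logOf xs).takeD n false = x.reverse := by
          rw [List.takeD_eq_take _ (by simp [hx]), List.take_left' (by simp [hx])]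
        have h₂ : (x.reverse ++ logOf xs).drop n = logOf xs :=
          List.drop_left' (by simp [hx])
        simp only [hs₁, Function.update_self, ne_eq, Nat.reduceEqDiff, not_false_eq_true,
          Function.update_of_ne, hN, hNil, hL', h₁, h₂, List.reverse_reverse, List.append_nil]
        funext r
        simp only [Function.update_apply]
        split_ifs <;> rfl
      · intro h
        rw [hs₃, if_pos h]
        exact Exec.push
      · intro l h
        rw [hs₃, if_neg (by simp [h])]
        exact Exec.skip
      · intro l h
        rw [hs₃, if_neg (by simp [h])]
        exact Exec.skip
      · have : (s₁ rTmp).length = n := by simp [hs₁, hX]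
        omega
    · rw [List.length_cons]
      nlinarith
    · rw [hb, hs₃' rArg (by decide), hs₂ rArg (by decide) (by decide) (by decide) (by decide)
        (by decide), List.mem_cons, hs₃]
      have hB := hs₂ rBad (by decide) (by decide) (by decide) (by decide) (by decide)
      split_ifs with h
      · simp [hd.1 h]
      · simp [hB, mt hd.2 h]
    · intro r h₁ h₂ h₃ h₄ h₅ h₆
      rw [hfr r h₁ h₂ h₃ h₄ h₅ h₆, hs₃' r h₆, hs₂ r h₁ h₂ h₃ h₄ h₅]

theorem exec_check {n : ℕ} (hn : 1 ≤ n) {xs : List Str} (hxs : ∀ x ∈ xs, x.length = n)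
    {O : Oracle} {s : Store} (hN : s rN = unary n) (hNil : s rNil = []) (hL : s rLog = logOf xs)
    {x : Str} (hx : (s (track 4 0)).takeD n false = x) {a : Str} (hO : O x = PMF.pure a)
    (ha : a.length ≤ n) :
    ∃ s', Exec O check s s'
        (xs.length * (16 * n + 30) + 70 * n + 9 * (s rEnc).length + 100) ∧
      (s' 0 = [true] ↔
        x ∉ xs ∧ x ++ a.leftpad n false ++ s rEnc <+: s (track 4 0)) := by
  have hx' : x.length = n := by simp [← hx]
  set y := s (track 4 0) with hy
  set s₁ : Store := update (update (update (update (update (update s rGen y) rBuf []) rCnt []) rTmp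
    (y.drop n)) rArg x) rBad [] with hs₁
  obtain ⟨s₂, he₂, hb₂, hr₂⟩ := exec_testFresh hn hxs (O := O) (s := s₁) (by simp [hs₁, hN])
    (by simp [hs₁, hNil]) (by simp [hs₁, hx']) (by simp [hs₁, hL])
  have hX₂ : s₂ rArg = x := by
    rw [hr₂ _ (by decide) (by decide) (by decide) (by decide) (by decide) (by decide)]
    simp [hs₁]
  have hE₂ : s₂ rEnc = s rEnc := by
    rw [hr₂ _ (by decide) (by decide) (by decide) (by decide) (by decide) (by decide)]
    simp [hs₁]
  have hG₂ : s₂ rGen = y := by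
    rw [hr₂ _ (by decide) (by decide) (by decide) (by decide) (by decide) (by decide)]
    simp [hs₁]
  have hNil₂ : s₂ rNil = [] := by
    rw [hr₂ _ (by decide) (by decide) (by decide) (by decide) (by decide) (by decide)]
    simp [hs₁, hNil]
  obtain ⟨s₃, he₃, hsmp, hr₃⟩ := exec_makeSample (n := n) (s := s₂)
    (by rw [hr₂ _ (by decide) (by decide) (by decide) (by decide) (by decide) (by decide)]
        simp [hs₁, hN]) hNil₂ (by rw [hX₂, hx']) a ha
  rw [hX₂, hE₂] at hsmp
  obtain ⟨s₄, he₄, hb₄, hr₄⟩ := Exec.testPrefix (O := O) (a := rSmp) (b := rGen) (d := rBad)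
      (by decide) (by decide) (by decide) (s := s₃) hsmp
  have hB₄ : s₄ rBad = [] ↔ x ∉ xs ∧ x ++ a.leftpad n false ++ s rEnc <+: y := by
    rw [hb₄, hr₃ rBad (by decide) (by decide) (by decide) (by decide) (by decide), hb₂,
      hr₃ rGen (by decide) (by decide) (by decide) (by decide) (by decide), hG₂]
    simp [hs₁]
  have hNil₄ : s₄ rNil = [] := by
    rw [hr₄ _ (by decide) (by decide) (by decide),
      hr₃ _ (by decide) (by decide) (by decide) (by decide) (by decide), hNil₂]
  refine ⟨update s₄ 0 (if s₄ rBad = [] then [true] else []),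
    (Exec.block_cons Exec.copy <| Exec.block_cons Exec.copy <| Exec.block_cons Exec.copy <|
    Exec.block_cons Exec.copy <|
    Exec.block_cons (Exec.moveCount (by decide) (by decide) (by decide) (n := n) ?_) <|
    Exec.block_cons Exec.copy <|
    Exec.block_cons (Exec.moveAll (by decide) (l := x.reverse) ?_) <|
    Exec.block_cons (Exec.copy.to (s'' := s₁) ?_ le_rfl) <| Exec.block_cons he₂ <|
    Exec.block_cons (he₃ O (by rw [hX₂, hO])) <| Exec.block_cons he₄ <|
    Exec.block_cons (Exec.branch (B := 5) ?_ ?_ ?_) Exec.block_nil).mono ?_, ?_⟩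
  · simp [hN, unary]
  · simp [hNil, ← hx, ← hy]
  · simp only [hs₁, Function.update_self, ne_eq, Nat.reduceEqDiff, not_false_eq_true,
      Function.update_of_ne, hN, hNil, hx, ← hy, List.reverse_reverse, List.append_nil]
    funext r
    simp only [Function.update_apply]
    split_ifs <;> simp_all
  · intro h
    refine (Exec.block_cons Exec.copy <| Exec.block_cons Exec.push Exec.block_nil).to ?_ (by simp)
    simp [h, hNil₄]
  · intro l h
    refine Exec.copy.to ?_ (by simp)
    simp [h, hNil₄]
  · intro l h
    refine Exec.copy.to ?_ (by simp)
    simp [h, hNil₄]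
  · simp [hx', List.leftpad]
    omega
  · rw [Function.update_self, ← hB₄]
    split_ifs with h <;> simp [h]

/-! ### Binary representations -/

theorem BINn_length {n x : ℕ} (h : (BIN x).length ≤ n) : (BINn n x).length = n := by
  simp [BINn, List.leftpad, h]

theorem BINn_injective {n a b : ℕ} (h : BINn n a = BINn n b) : a = b := by
  have key (x : ℕ) :
      Nat.ofDigits 2 ((BINn n x).reverse.map fun b => cond b 1 0) = x := by
    rw [BINn, List.leftpad, List.reverse_append, List.map_append, Nat.ofDigits_append,
      List.reverse_replicate, List.map_replicate]
    have h0 (k : ℕ) : Nat.ofDigits 2 (List.replicate k (cond false 1 0)) = 0 := by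
      induction k with
      | zero => rfl
      | succ k ih => rw [List.replicate_succ, Nat.ofDigits_cons, ih]; rfl
    rw [h0, BIN]
    split_ifs with hx
    · simp [hx]
    · rw [List.reverse_reverse, ← Nat.digits_two_eq_bits, Nat.ofDigits_digits]
      simp
  rw [← key a, h, key b]

/-! ### The distinguisher up to the simulation of the learner -/

/-- The bookkeeping registers of the distinguisher after samples for the arguments `xs`. -/
structure Ready (n : ℕ) (e : Str) (xs : List Str) (s : Store) : Prop where
  param : s rN = unary n
  enc : s rEnc = e
  nil : s rNil = []
  log : s rLog = logOf xs
  len : ∀ x ∈ xs, x.length = n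

theorem Ready.congr {n : ℕ} {e : Str} {xs : List Str} {s s' : Store} (h : Ready n e xs s)
    (hs : ∀ r, r % 5 = 0 → s' r = s r) : Ready n e xs s' :=
  ⟨by rw [hs _ rfl, h.param], by rw [hs _ rfl, h.enc], by rw [hs _ rfl, h.nil],
    by rw [hs _ rfl, h.log], h.len⟩

section Setup

variable {n : ℕ} {e P : Str} {s s' : Store}

theorem load_singleton (P : Str) (i : ℕ) : load [P] i = if i = 0 then P else [] := by
  cases i <;> simp [load]

theorem setup_recover : update (load [P]) (track 1 0) (load [P] 0) ∘ track 1 = load [P] := by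
  funext i
  rcases i with _ | i <;> simp [track, load_singleton]

variable (hs : ∀ r ∉ Set.range (track 1), s r = update (load [P]) (track 1 0) (load [P] 0) r)
include hs

theorem setup_off {r : ℕ} (hr : r % 5 ≠ 1) : s r = load [P] r := by
  rw [hs r (notMem_range_track (by norm_num) hr), Function.update_of_ne]
  rintro rfl
  simp [track] at hr

/-- The store before the parameterization is encoded. -/
theorem setup_encode :
    update (update s rN (s (track 1 0))) (track 2 0) (update s rN (s (track 1 0)) 0) ∘ track 2
      = load [P] := by
  funext i
  have h₁ := setup_off hs (r := track 2 i) (by unfold track; omega)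
  have h₂ := setup_off hs (r := 0) (by norm_num)
  simp only [Function.comp_apply, Function.update_apply, load_singleton, track] at *
  split_ifs <;> first | omega | simp_all

/-- The store before the learner is run. -/
theorem setup_learn (hn : s (track 1 0) = unary n)
    (hs' : ∀ r ∉ Set.range (track 2), s' r = update (update s rN (s (track 1 0))) (track 2 0)
      (update s rN (s (track 1 0)) 0) r) (he : s' (track 2 0) = e) :
    Ready n e [] (update (update s' rEnc (s' (track 2 0))) (track 3 0)
        (update s' rEnc (s' (track 2 0)) rN)) ∧
      update (update s' rEnc (s' (track 2 0))) (track 3 0)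
        (update s' rEnc (s' (track 2 0)) rN) ∘ track 3 = load [unary n] ∧
      update (update s' rEnc (s' (track 2 0))) (track 3 0)
        (update s' rEnc (s' (track 2 0)) rN) ∘ track 4 = load [] := by
  have hN : s' rN = unary n := by
    rw [hs' _ (notMem_range_track (by norm_num) (by norm_num))]
    simpa [track] using hn
  have hoff (r : ℕ) (h₁ : r % 5 ≠ 1) (h₂ : r % 5 ≠ 2) (h₀ : r ≠ 0) (h₃ : r ≠ rN) : s' r = [] := by
    rw [hs' _ (notMem_range_track (by norm_num) h₂), Function.update_of_ne,
      Function.update_of_ne h₃, setup_off hs h₁, load_singleton, if_neg h₀]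
    rintro rfl
    simp [track] at h₂
  refine ⟨⟨?_, ?_, ?_, ?_, by simp⟩, ?_, ?_⟩
  · simp [track, hN]
  · simp [track, ← he]
  · simpa [track] using hoff rNil (by norm_num) (by norm_num) (by norm_num) (by norm_num)
  · simpa [track, logOf] using hoff rLog (by norm_num) (by norm_num) (by norm_num) (by norm_num)
  · funext i
    rcases i with _ | i
    · simp [track, load, hN]
    · have := hoff (track 3 (i + 1)) (by unfold track; omega) (by unfold track; omega)
        (by unfold track; omega) (by unfold track; omega)
      rw [Function.comp_apply, Function.update_of_ne ((track_injective 3).ne (by omega)),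
        Function.update_of_ne (by unfold track; omega), this]
      simp [load]
  · funext i
    have := hoff (track 4 i)
    simp only [Function.comp_apply, Function.update_apply, track] at *
    split_ifs <;> first | omega | skip
    rw [this (by omega) (by omega) (by omega) (by omega)]
    simp [load]

end Setup

theorem acc_zero_cons (O : Oracle) (p : Prog) (K : List Prog) (s : Store) :
    acc O 0 (p :: K, s) = 0 := by
  simp [acc, run, expect_pure, result]

theorem answer_ready {n : ℕ} {e : Str} {xs : List Str} {s : Store} (h : Ready n e xs s) (j : ℕ) :
    ∃ post : Str → Str → Store,
      (∀ x a, x.length = n → a.length ≤ n → Ready n e (x :: xs) (post x a) ∧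
        post x a ∘ track 3 = update (s ∘ track 3) j (x ++ a.leftpad n false ++ e) ∧
        post x a ∘ track 4 = s ∘ track 4) ∧
      ∀ (O : Oracle) (a : Str → Str),
        (∀ x ∈ bitStrings n, O x = PMF.pure (a x) ∧ (a x).length ≤ n) → ∀ K t,
        acc O (t + 1) (answer (track 3 j) :: K, s)
          ≤ ∑ x ∈ bitStrings n, (2⁻¹ : ℝ≥0∞) ^ n * acc O t (K, post x (a x)) ∧
        ∑ x ∈ bitStrings n, (2⁻¹ : ℝ≥0∞) ^ n * acc O t (K, post x (a x))
          ≤ acc O (40 * n + 70 + t) (answer (track 3 j) :: K, s) := by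
  obtain ⟨post, hpost, hacc⟩ := answer_spec h.param h.nil (j := track 3 j) (by unfold track; omega)
  refine ⟨post, fun x a hx ha => ?_, hacc⟩
  obtain ⟨hj, hL, hr⟩ := hpost x a hx ha
  have hj' : track 3 j % 5 = 3 := by unfold track; omega
  refine ⟨⟨?_, ?_, ?_, ?_, ?_⟩, ?_, ?_⟩
  · rw [hr _ (by decide) (by decide) (by decide) (by decide) (by decide) (by decide) (by decide)
      (by omega), h.param]
  · rw [hr _ (by decide) (by decide) (by decide) (by decide) (by decide) (by decide) (by decide)
      (by omega), h.enc]
  · rw [hr _ (by decide) (by decide) (by decide) (by decide) (by decide) (by decide) (by decide)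
      (by omega), h.nil]
  · rw [hL, h.log]
    simp [logOf]
  · simpa [hx] using h.len
  · funext i
    have hi : track 3 i % 5 = 3 := by unfold track; omega
    by_cases hij : i = j
    · subst hij
      simp [hj, h.enc]
    · rw [Function.update_of_ne hij, Function.comp_apply, hr _ (by omega) (by omega) (by omega)
        (by omega) (by omega) (by omega) (by omega) ((track_injective 3).ne hij),
        Function.comp_apply]
  · funext i
    have hi : track 4 i % 5 = 4 := by unfold track; omega
    rw [Function.comp_apply, hr _ (by omega) (by omega) (by omega)
        (by omega) (by omega) (by omega) (by omega) (by omega), Function.comp_apply]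

/-! ### Random functions -/

section Ideal

variable {X : Finset Str} {Y : Finset ℕ}

/-- The set `S` of functions restricts values only at the arguments `xs`. -/
def FreeOutside (S : Finset ({x // x ∈ X} → {y // y ∈ Y})) (xs : List Str) : Prop :=
  ∀ R ∈ S, ∀ x : {x // x ∈ X}, x.1 ∉ xs → ∀ y, update R x y ∈ S

theorem FreeOutside.filter {S : Finset ({x // x ∈ X} → {y // y ∈ Y})} {xs : List Str}
    (h : FreeOutside S xs) (x : {x // x ∈ X}) (y : {y // y ∈ Y}) :
    FreeOutside (S.filter fun R => R x = y) (x.1 :: xs) := by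
  intro R hR x' hx' y'
  rw [Finset.mem_filter] at hR ⊢
  rw [List.mem_cons, not_or] at hx'
  refine ⟨h R hR.1 x' hx'.2 y', ?_⟩
  rw [Function.update_of_ne, hR.2]
  rintro rfl
  exact hx'.1 rfl

/-- A prescribed value at an unrestricted argument is taken by at most half of the functions. -/
theorem FreeOutside.two_mul_card_filter_le {S : Finset ({x // x ∈ X} → {y // y ∈ Y})}
    {xs : List Str} (h : FreeOutside S xs) (hY : 2 ≤ Y.card) (x : {x // x ∈ X}) (hx : x.1 ∉ xs)
    (y : {y // y ∈ Y}) : 2 * (S.filter fun R => R x = y).card ≤ S.card := by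
  obtain ⟨y', hy'⟩ : ∃ y' : {y // y ∈ Y}, y' ≠ y := by
    have : Nontrivial {y // y ∈ Y} := by
      rw [← Fintype.one_lt_card_iff_nontrivial, Fintype.card_coe]
      omega
    exact exists_ne y
  have hle : (S.filter fun R => R x = y).card ≤ (S.filter fun R => R x = y').card := by
    refine Finset.card_le_card_of_injOn (fun R => update R x y') (fun R hR => ?_) ?_
    · simp only [Finset.coe_filter, Set.mem_ofPred_eq] at hR
      simp only [Finset.coe_filter, Set.mem_ofPred_eq, Function.update_self, and_true]
      exact h R hR.1 x hx y'
    · intro R hR R' hR' heq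
      simp only [Finset.coe_filter, Set.mem_ofPred_eq] at hR hR'
      funext z
      by_cases hz : z = x
      · rw [hz, hR.2, hR'.2]
      · simpa [hz] using congrFun heq z
  have hdisj : Disjoint (S.filter fun R => R x = y) (S.filter fun R => R x = y') := by
    rw [Finset.disjoint_filter]
    intro R _ h₁ h₂
    exact hy' (h₂.symm.trans h₁)
  have := Finset.card_le_card (Finset.union_subset (Finset.filter_subset (fun R => R x = y) S)
    (Finset.filter_subset (fun R => R x = y') S))
  rw [Finset.card_union_of_disjoint hdisj] at this
  omega

/-- The membership oracle of a function with values in `Y`. -/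
noncomputable def oracleOf (R : {x // x ∈ X} → {y // y ∈ Y}) : Oracle := MQ X fun x => (R x : ℕ)

theorem oracleOf_apply (R : {x // x ∈ X} → {y // y ∈ Y}) {x : Str} (hx : x ∈ X) :
    oracleOf R x = PMF.pure (BIN (R ⟨x, hx⟩)) := by
  simp [oracleOf, MQ, hx]

variable {n : ℕ} (hn : 1 ≤ n) (hX : ∀ x, x ∈ X ↔ x.length = n)
  (hYn : ∀ y ∈ Y, (BIN y).length ≤ n) (hY : 2 ≤ Y.card) {e : Str}
include hn hX hYn hY

theorem sum_acc_check_le {S : Finset ({x // x ∈ X} → {y // y ∈ Y})} {xs : List Str} {s : Store}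
    (hs : Ready n e xs s) (hS : FreeOutside S xs) (t : ℕ) :
    ∑ R ∈ S, acc (oracleOf R) t ([check, block []], s) ≤ (S.card : ℝ≥0∞) / 2 := by
  classical
  have hx : ((s (track 4 0)).takeD n false).length = n := by simp
  set x : {x // x ∈ X} := ⟨(s (track 4 0)).takeD n false, (hX _).2 hx⟩ with hxdef
  let good (R : {x // x ∈ X} → {y // y ∈ Y}) : Prop :=
    x.1 ∉ xs ∧ x.1 ++ BINn n (R x) ++ s rEnc <+: s (track 4 0)
  have h₁ (R) : acc (oracleOf R) t ([check, block []], s) ≤ if good R then 1 else 0 := by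
    obtain ⟨s', he, hs'⟩ := exec_check hn hs.len hs.param hs.nil hs.log (x := x.1) rfl
      (oracleOf_apply R x.2) (hYn _ (R x).2)
    refine (he.acc_le _ t).trans ((Exec.skip.acc_le _ t).trans ?_)
    rw [acc_nil]
    exact le_of_eq (if_congr hs' rfl rfl)
  have h₂ : 2 * (S.filter good).card ≤ S.card := by
    rcases (S.filter good).eq_empty_or_nonempty with h | ⟨R, hR⟩
    · simp [h]
    · obtain ⟨-, hR₁, hR₂⟩ := Finset.mem_filter.1 hR
      refine le_trans (Nat.mul_le_mul_left 2 (Finset.card_le_card fun R' hR' => ?_))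
        (hS.two_mul_card_filter_le hY x hR₁ (R x))
      obtain ⟨hR'S, -, hR'₂⟩ := Finset.mem_filter.1 hR'
      refine Finset.mem_filter.2 ⟨hR'S, Subtype.ext (BINn_injective (n := n) ?_)⟩
      have hl₁ := BINn_length (hYn _ (R x).2)
      have hl₂ := BINn_length (hYn _ (R' x).2)
      have := (List.prefix_of_prefix_length_le hR'₂ hR₂ (by simp [hl₁, hl₂])).eq_of_length
        (by simp [hl₁, hl₂])
      simpa using this
  calc _ ≤ ∑ R ∈ S, (if good R then (1 : ℝ≥0∞) else 0) := Finset.sum_le_sum fun R _ => h₁ R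
    _ = ((S.filter good).card : ℝ≥0∞) := by rw [Finset.sum_boole]
    _ ≤ _ := by
      rw [ENNReal.le_div_iff_mul_le (by simp) (by simp), mul_comm]
      exact_mod_cast h₂

theorem sum_acc_judge_le (G : Prog) {S : Finset ({x // x ∈ X} → {y // y ∈ Y})} {xs : List Str}
    {s : Store} (hs : Ready n e xs s) (hS : FreeOutside S xs) (t : ℕ) :
    ∑ R ∈ S, acc (oracleOf R) t ([judge G], s) ≤ (S.card : ℝ≥0∞) / 2 := by
  set s₁ : Store := update s (track 4 0) (s rN) with hs₁
  set s₂ : Store := update s₁ (track 4 1) (s₁ (track 3 0)) with hs₂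
  have h₂ : ∀ r, r % 5 = 0 → s₂ r = s r := by
    intro r hr
    rw [hs₂, hs₁, Function.update_of_ne, Function.update_of_ne] <;>
    · rintro rfl
      simp [track] at hr
  have hr₂ := hs.congr h₂
  refine (Finset.sum_le_sum fun R _ => ?_).trans (sum_acc_offline_le (O := oracleOf)
    (track_injective 4)
    (notMem_range_track (r := rNil) (by norm_num) (by norm_num)) _ [block [check]] t [G] s₂ hr₂.nil
    fun s' t' hs' => ?_)
  · refine (acc_seq_le _ _ _ _ t s).trans ((Exec.copy.acc_le _ t).trans ?_)
    refine (acc_seq_le _ _ _ _ t _).trans ((Exec.copy.acc_le _ t).trans ?_)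
    exact acc_seq_le _ _ _ _ t _
  · refine le_trans (Finset.sum_le_sum fun R _ => acc_seq_le _ _ _ _ t' _)
      (sum_acc_check_le hn hX hYn hY (hr₂.congr fun r hr => hs' r ?_) hS t')
    exact notMem_range_track (by norm_num) (by omega)

/-- Whatever the learner does, and whether or not it halts, a random function is guessed at a fresh
argument with probability at most `1 / 2`. -/
theorem sum_acc_sim_le (G : Prog) (t : ℕ) (K : List Prog)
    (S : Finset ({x // x ∈ X} → {y // y ∈ Y})) (xs : List Str)
    (s : Store) (hs : Ready n e xs s) (hS : FreeOutside S xs) :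
    ∑ R ∈ S, acc (oracleOf R) t
      (K.map (sim (track 3) fun _ j => answer (track 3 j)) ++ [judge G], s)
      ≤ (S.card : ℝ≥0∞) / 2 := by
  classical
  induction t generalizing K S xs s with
  | zero => cases K <;> simp [acc_zero_cons]
  | succ t ih =>
    cases K with
    | nil => exact sum_acc_judge_le hn hX hYn hY G hs hS _
    | cons p K =>
      by_cases hp : ∃ i j, p = .query i j
      · obtain ⟨i, j, rfl⟩ := hp
        obtain ⟨post, hpost, hacc⟩ := answer_ready hs j
        set K₁ := K.map (sim (track 3) fun _ j => answer (track 3 j)) ++ [judge G] with hK₁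
        -- the value at each argument, as the oracle returns it
        let a (R : {x // x ∈ X} → {y // y ∈ Y}) (x : Str) : Str :=
          if h : x ∈ X then BIN (R ⟨x, h⟩) else []
        have ha (R) (x) (hx : x ∈ bitStrings n) :
            oracleOf R x = PMF.pure (a R x) ∧ (a R x).length ≤ n := by
          have hx' : x ∈ X := (hX x).2 (mem_bitStrings.1 hx)
          simp only [a, dif_pos hx', oracleOf_apply R hx', true_and]
          exact hYn _ (R _).2
        calc _ ≤ ∑ R ∈ S, ∑ x ∈ bitStrings n, (2⁻¹ : ℝ≥0∞) ^ n *
                acc (oracleOf R) t (K₁, post x (a R x)) :=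
              Finset.sum_le_sum fun R _ => (hacc (oracleOf R) (a R) (ha R) K₁ t).1
          _ = ∑ x ∈ bitStrings n, (2⁻¹ : ℝ≥0∞) ^ n *
                ∑ R ∈ S, acc (oracleOf R) t (K₁, post x (a R x)) := by
              rw [Finset.sum_comm]
              simp only [Finset.mul_sum]
          _ ≤ ∑ x ∈ bitStrings n, (2⁻¹ : ℝ≥0∞) ^ n * ((S.card : ℝ≥0∞) / 2) := by
              refine Finset.sum_le_sum fun x hx => mul_le_mul_right ?_ _
              have hxn := mem_bitStrings.1 hx
              have hxX : x ∈ X := (hX x).2 hxn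
              rw [← Finset.sum_fiberwise S (fun R => R ⟨x, hxX⟩),
                Finset.card_eq_sum_card_fiberwise (f := fun R => R ⟨x, hxX⟩)
                  (t := Finset.univ) (fun _ _ => Finset.mem_coe.2 (Finset.mem_univ _)),
                Nat.cast_sum, div_eq_mul_inv, Finset.sum_mul]
              refine Finset.sum_le_sum fun y _ => ?_
              rw [← div_eq_mul_inv]
              refine le_trans (le_of_eq (Finset.sum_congr rfl fun R hR => ?_))
                (ih K _ (x :: xs) (post x (BIN y)) (hpost x _ hxn (hYn _ y.2)).1
                  (hS.filter ⟨x, hxX⟩ y))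
              rw [Finset.mem_filter] at hR
              simp only [a, dif_pos hxX, hR.2, hK₁]
          _ = _ := by
              rw [Finset.sum_const, card_bitStrings, nsmul_eq_mul, ← mul_assoc]
              rw [Nat.cast_pow, ← mul_pow, Nat.cast_ofNat,
                ENNReal.mul_inv_cancel (by simp) (by simp), one_pow, one_mul]
      · rw [Finset.sum_congr rfl fun R _ => acc_sim_cons (track_injective 3) _ (oracleOf R)
          noOracle t p K _ s fun i j h => absurd ⟨i, j, h⟩ hp, ← expect_sum]
        refine expect_le fun c _ => ih c.1 S xs _ (hs.congr fun r hr => extend_off _ _ ?_) hS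
        exact notMem_range_track (by norm_num) (by omega)

theorem sum_acc_distinguisher_le {R E : Prog} (A G : Prog) {P : Str} {T T' : ℕ}
    (hR : Computes R [P] (unary n) T) (hE : Computes E [P] e T') (t : ℕ) :
    ∑ f : {x // x ∈ X} → {y // y ∈ Y}, acc (oracleOf f) t ([distinguisher R E A G], load [P])
      ≤ (Fintype.card ({x // x ∈ X} → {y // y ∈ Y}) : ℝ≥0∞) / 2 := by
  have hnil₁ : update (load [P]) (track 1 0) (load [P] 0) rNil = [] := by
    simp [track, load_singleton]
  refine (Finset.sum_le_sum fun f _ => ?_).trans (sum_acc_offline_le_of_computes (O := oracleOf)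
    (track_injective 1) (notMem_range_track (r := rNil) (by norm_num) (by norm_num)) _
    [encodeLearn E A G] hR t _
    hnil₁ setup_recover fun s t₁ hs hsn => ?_)
  · refine (acc_seq_le _ _ _ _ t _).trans ((Exec.copy.acc_le _ t).trans ?_)
    exact acc_seq_le _ _ _ _ t _
  have hnil₂ : update (update s rN (s (track 1 0))) (track 2 0)
      (update s rN (s (track 1 0)) 0) rNil = [] := by
    simp [track, setup_off hs (r := rNil) (by norm_num), load_singleton]
  refine (Finset.sum_le_sum fun f _ => ?_).trans (sum_acc_offline_le_of_computes (O := oracleOf)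
    (track_injective 2) (notMem_range_track (r := rNil) (by norm_num) (by norm_num)) _
    [learn A G] hE t₁ _
    hnil₂ (setup_encode hs) fun s' t₂ hs' hse => ?_)
  · refine (acc_seq_le _ _ _ _ t₁ _).trans ((Exec.copy.acc_le _ t₁).trans ?_)
    refine (acc_seq_le _ _ _ _ t₁ _).trans ((Exec.copy.acc_le _ t₁).trans ?_)
    exact acc_seq_le _ _ _ _ t₁ _
  obtain ⟨hready, -, -⟩ := setup_learn hs hsn hs' hse
  refine (Finset.sum_le_sum fun f _ => ?_).trans ((sum_acc_sim_le hn hX hYn hY G t₂ [A]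
    Finset.univ [] _ hready fun _ _ _ _ _ => Finset.mem_univ _).trans_eq (by rw [Finset.card_univ]))
  refine (acc_seq_le _ _ _ _ t₂ _).trans ((Exec.copy.acc_le _ t₂).trans ?_)
  refine (acc_seq_le _ _ _ _ t₂ _).trans ((Exec.copy.acc_le _ t₂).trans ?_)
  exact acc_seq_le _ _ _ _ t₂ _

end Ideal

/-! ### Real functions -/

section Real

variable {n : ℕ} (hn : 1 ≤ n) {O : Oracle} {a : Str → Str}
  (ha : ∀ x ∈ bitStrings n, O x = PMF.pure (a x) ∧ (a x).length ≤ n) {e : Str}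
include hn ha

/-- The acceptance probability is at least the probability that the generator outputs a correct
string with a fresh argument. -/
theorem le_acc_judge (G : Prog) {xs : List Str} {s : Store} (hs : Ready n e xs s)
    (hG : s ∘ track 4 = load []) (T : ℕ) :
    ∑ x ∈ bitStrings n with x ∉ xs, exec noOracle G [unary n, s (track 3 0)] T
        (some (x ++ (a x).leftpad n false ++ e))
      ≤ acc O (T + xs.length * (16 * n + 30) + 70 * n + 9 * e.length + 110) ([judge G], s) := by
  classical
  set s₁ : Store := update s (track 4 0) (s rN) with hs₁
  set s₂ : Store := update s₁ (track 4 1) (s₁ (track 3 0)) with hs₂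
  have h₂ : ∀ r, r % 5 = 0 → s₂ r = s r := by
    intro r hr
    rw [hs₂, hs₁, Function.update_of_ne, Function.update_of_ne] <;>
    · rintro rfl
      simp [track] at hr
  have hr₂ := hs.congr h₂
  have hload : s₂ ∘ track 4 = load [unary n, s (track 3 0)] := by
    funext i
    have hi := congrFun hG i
    simp only [Function.comp_apply, track] at hi
    rcases i with _ | _ | i
    · simp [hs₂, hs₁, track, load, hs.param]
    · simp [hs₂, hs₁, track, load]
    · simp only [hs₂, hs₁, track, load, Function.comp_apply]
      rw [Function.update_of_ne (by omega), Function.update_of_ne (by omega), hi]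
      simp [load]
  set B : ℕ := xs.length * (16 * n + 30) + 70 * n + 9 * e.length + 100 with hB
  set F : Finset Str := (bitStrings n).filter fun x => x ∉ xs with hF
  set smp : Str → Str := fun x => x ++ (a x).leftpad n false ++ e with hsmp
  set W : Store → ℝ≥0∞ := fun s₀ => if ∃ x ∈ F, s₀ 0 = smp x then 1 else 0 with hW
  have hinj : ∀ x ∈ F, ∀ y ∈ F, smp x = smp y → x = y := by
    intro x hx y hy hxy
    have hx' := mem_bitStrings.1 (Finset.mem_filter.1 hx).1
    have hy' := mem_bitStrings.1 (Finset.mem_filter.1 hy).1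
    simp only [hsmp, List.append_assoc] at hxy
    exact (List.append_inj hxy (hx'.trans hy'.symm)).1
  have hcheck (s' : Store) (hs' : ∀ r ∉ Set.range (track 4), s' r = s₂ r) :
      W (s' ∘ track 4) ≤ acc O (B + 3) ([block [check]], s') := by
    have hr' : Ready n e xs s' :=
      hr₂.congr fun r hr => hs' r (notMem_range_track (by norm_num) (by omega))
    simp only [hW, Function.comp_apply]
    split_ifs with hx
    swap
    · exact zero_le
    obtain ⟨x, hxF, hx⟩ := hx
    obtain ⟨hxn, hxs⟩ := Finset.mem_filter.1 hxF
    have hxl := mem_bitStrings.1 hxn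
    obtain ⟨s₃, he, hs₃⟩ := exec_check hn hr'.len hr'.param hr'.nil hr'.log (x := x)
      (by
        rw [hx]
        simp only [hsmp, List.append_assoc]
        rw [List.takeD_eq_take _ (by simp [hxl]), List.take_left' hxl])
      (ha x hxn).1 (ha x hxn).2
    rw [hr'.enc] at he hs₃
    calc (1 : ℝ≥0∞) = acc O 1 ([], s₃) := by
          rw [acc_nil, if_pos (hs₃.2 ⟨hxs, by rw [hx]⟩)]
      _ ≤ acc O (1 + 1) ([block []], s₃) := Exec.skip.le_acc [] 1
      _ ≤ acc O (B + (1 + 1)) ([check, block []], s') := he.le_acc _ _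
      _ = acc O (B + 3) ([block [check]], s') := (acc_seq O _ _ _ _ _).symm
  calc _ = expect (run noOracle T ([G], s₂ ∘ track 4))
        (fun c => ∑ x ∈ F, if result c = some (smp x) then 1 else 0) := by
        rw [expect_sum, hload]
        refine Finset.sum_congr rfl fun x _ => ?_
        rw [exec, apply_eq_expect, expect_map]
    _ ≤ expect (run noOracle T ([G], s₂ ∘ track 4)) (fun c => if c.1 = [] then W c.2 else 0) := by
        refine expect_mono fun c _ => ?_
        obtain ⟨_ | _, s₀⟩ := c
        · simp only [result, if_true, hW, Option.some.injEq]
          split_ifs with hx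
          · obtain ⟨x, hxF, hx⟩ := hx
            rw [Finset.sum_eq_single x]
            · simp [hx]
            · intro y hy hyx
              rw [if_neg]
              intro h
              exact hyx (hinj y hy x hxF (h.symm.trans hx))
            · exact fun h => absurd hxF h
          · refine le_of_eq (Finset.sum_eq_zero fun x hxF => if_neg fun h => hx ⟨x, hxF, h⟩)
        · simp [result]
    _ ≤ acc O (T + (B + 3)) ([offline (track 4) rNil G, block [check]], s₂) :=
        le_acc_offline (track_injective 4)
          (notMem_range_track (r := rNil) (by norm_num) (by norm_num)) O W (B + 3) [block [check]]
          T [G] s₂ hr₂.nil hcheck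
    _ = _ := (acc_seq O _ _ _ _ _).symm
    _ ≤ _ := Exec.copy.le_acc _ _
    _ = _ := (acc_seq O _ _ _ _ _).symm
    _ ≤ _ := Exec.copy.le_acc _ _
    _ = _ := (acc_seq O _ _ _ _ s).symm
    _ ≤ _ := acc_mono O (by omega) _

omit hn in
/-- The simulation of the learner is faithful; `W` bounds the acceptance probability after it from
below, for logs of length at most `ℓ`. -/
theorem le_acc_sim (W : Store → ℝ≥0∞) (G : Prog) (t ℓ : ℕ)
    (hW : ∀ xs s, Ready n e xs s → s ∘ track 4 = load [] → xs.length ≤ ℓ →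
      W (s ∘ track 3) ≤ acc O t ([judge G], s)) (T : ℕ) (K : List Prog) (xs : List Str) (s : Store)
    (hs : Ready n e xs s) (hG : s ∘ track 4 = load []) (hxs : xs.length + T ≤ ℓ) :
    expect (run (SAMPLE ((PMF.uniformOfFinset (bitStrings n) (bitStrings_nonempty n)).map
        fun x => x ++ (a x).leftpad n false ++ e)) T (K, s ∘ track 3))
        (fun c => if c.1 = [] then W c.2 else 0)
      ≤ acc O ((40 * n + 70) * T + t)
          (K.map (sim (track 3) fun _ j => answer (track 3 j)) ++ [judge G], s) := by
  induction T generalizing K xs s with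
  | zero =>
    cases K with
    | nil => simpa [run, expect_pure] using hW xs s hs hG hxs
    | cons p K => simp [run, expect_pure]
  | succ T ih =>
    cases K with
    | nil =>
      rw [run_nil, expect_pure, if_pos rfl]
      exact (hW xs s hs hG (by omega)).trans (acc_mono O (Nat.le_add_left _ _) _)
    | cons p K =>
      rw [run, expect_bind]
      by_cases hp : ∃ i j, p = .query i j
      · obtain ⟨i, j, rfl⟩ := hp
        obtain ⟨post, hpost, hacc⟩ := answer_ready hs j
        rw [step, SAMPLE, PMF.map_comp, expect_map, expect_uniformOfFinset, card_bitStrings]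
        refine (Finset.sum_le_sum fun x hx => ?_).trans ((hacc O a ha _ _).2.trans
          (acc_mono O (t := 40 * n + 70 + ((40 * n + 70) * T + t)) ?_ _))
        · rw [Nat.cast_pow, ENNReal.inv_pow, Nat.cast_ofNat]
          refine mul_le_mul_right ?_ _
          obtain ⟨h₁, h₂, h₃⟩ := hpost x (a x) (mem_bitStrings.1 hx) (ha x hx).2
          have := ih K _ _ h₁ (h₃.trans hG) (by rw [List.length_cons]; omega)
          rwa [h₂] at this
        · rw [Nat.mul_succ]
          omega
      · refine le_trans ?_ (acc_mono O (t := (40 * n + 70) * T + t + 1) ?_ _)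
        · rw [acc_sim_cons (track_injective 3) _ O _ _ p K _ s fun i j h => absurd ⟨i, j, h⟩ hp]
          refine expect_mono fun c _ => ?_
          have := ih c.1 xs (extend (track 3) c.2 s) (hs.congr fun r hr => extend_off _ _ ?_) ?_
            (by omega)
          · rwa [Function.extend_comp (track_injective 3)] at this
          · exact notMem_range_track (by norm_num) (by omega)
          · rw [← hG]
            funext i
            exact extend_off _ _ (notMem_range_track (by norm_num) (by unfold track; omega))
        · rw [Nat.mul_succ]
          omega

/-- If all descriptions in `good` lead to acceptance with probability at least `c`, for every log
that is not too long, then the distinguisher accepts with probability at least `c` times the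
probability that the learner outputs one of them. -/
theorem le_acc_distinguisher {R E : Prog} (A G : Prog) {P : Str} {T₁ T₂ : ℕ}
    (hR : Computes R [P] (unary n) T₁) (hE : Computes E [P] e T₂) (T : ℕ) (c : ℝ≥0∞)
    (good : Set Str)
    (hgood : ∀ h ∈ good, ∀ xs : List Str, xs.length ≤ T →
      c ≤ ∑ x ∈ bitStrings n with x ∉ xs, exec noOracle G [unary n, h] T
        (some (x ++ (a x).leftpad n false ++ e))) :
    (exec (SAMPLE ((PMF.uniformOfFinset (bitStrings n) (bitStrings_nonempty n)).map
        fun x => x ++ (a x).leftpad n false ++ e)) A [unary n] T).toOuterMeasure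
        {o | ∃ h, o = some h ∧ h ∈ good} * c
      ≤ acc O (T₁ + T₂ + (40 * n + 70) * T + T + T * (16 * n + 30) + 70 * n + 9 * e.length + 200)
          ([distinguisher R E A G], load [P]) := by
  classical
  set D := (PMF.uniformOfFinset (bitStrings n) (bitStrings_nonempty n)).map
        fun x => x ++ (a x).leftpad n false ++ e with hD
  set W : Store → ℝ≥0∞ := fun s => if s 0 ∈ good then c else 0 with hW
  set t := T + T * (16 * n + 30) + 70 * n + 9 * e.length + 110 with ht
  set v := expect (run (SAMPLE D) T ([A], load [unary n])) (fun c => if c.1 = [] then W c.2 else 0)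
    with hv
  have hWt (xs : List Str) (s : Store) (hs : Ready n e xs s) (hG : s ∘ track 4 = load [])
      (hxs : xs.length ≤ T) : W (s ∘ track 3) ≤ acc O t ([judge G], s) := by
    simp only [hW, Function.comp_apply]
    split_ifs with h
    · refine (hgood _ h xs hxs).trans ((le_acc_judge hn ha G hs hG T).trans (acc_mono O ?_ _))
      have := Nat.mul_le_mul_right (16 * n + 30) hxs
      omega
    · exact zero_le
  have hstart : (exec (SAMPLE D) A [unary n] T).toOuterMeasure {o | ∃ h, o = some h ∧ h ∈ good} * c
      = v := by
    rw [exec, PMF.toOuterMeasure_map_apply, PMF.toOuterMeasure_apply, ← ENNReal.tsum_mul_right, hv,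
      expect]
    refine tsum_congr fun x => ?_
    obtain ⟨_ | _, s₀⟩ := x
    · simp only [Set.indicator_apply, hW, Set.mem_preimage, Set.mem_ofPred_eq, result, if_true,
        Option.some.injEq, exists_eq_left']
      split_ifs <;> simp
    · simp [result]
  have hnil₁ : update (load [P]) (track 1 0) (load [P] 0) rNil = [] := by
    simp [track, load_singleton]
  rw [hstart]
  have h₃ (s s' : Store)
      (hs : ∀ r ∉ Set.range (track 1), s r = update (load [P]) (track 1 0) (load [P] 0) r)
      (hsn : s (track 1 0) = unary n)
      (hs' : ∀ r ∉ Set.range (track 2), s' r = update (update s rN (s (track 1 0))) (track 2 0)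
        (update s rN (s (track 1 0)) 0) r) (hse : s' (track 2 0) = e) :
      v ≤ acc O ((40 * n + 70) * T + t + 10)
        ([learn A G], s') := by
    obtain ⟨hready, hA, hG⟩ := setup_learn hs hsn hs' hse
    have := le_acc_sim ha W G t T hWt T [A] [] _ hready hG (by simp)
    rw [hA] at this
    refine this.trans ((acc_seq O _ _ _ _ _).symm.le.trans ((Exec.copy.le_acc _ _).trans
      ((acc_seq O _ _ _ _ _).symm.le.trans ((Exec.copy.le_acc _ _).trans
      ((acc_seq O _ _ _ _ _).symm.le.trans (acc_mono O ?_ _))))))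
    omega
  have h₂ (s : Store)
      (hs : ∀ r ∉ Set.range (track 1), s r = update (load [P]) (track 1 0) (load [P] 0) r)
      (hsn : s (track 1 0) = unary n) :
      v ≤ acc O (T₂ + ((40 * n + 70) * T + t) + 20)
        ([encodeLearn E A G], s) := by
    have hnil₂ : update (update s rN (s (track 1 0))) (track 2 0)
        (update s rN (s (track 1 0)) 0) rNil = [] := by
      simp [track, setup_off hs (r := rNil) (by norm_num), load_singleton]
    refine (le_acc_offline_of_computes (track_injective 2)
      (notMem_range_track (r := rNil) (by norm_num) (by norm_num)) O v _ hE _ _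
      hnil₂ (setup_encode hs) fun s' hs' hse => h₃ s s' hs hsn hs' hse).trans ?_
    refine (acc_seq O _ _ _ _ _).symm.le.trans ((Exec.copy.le_acc _ _).trans
      ((acc_seq O _ _ _ _ _).symm.le.trans ((Exec.copy.le_acc _ _).trans
      ((acc_seq O _ _ _ _ _).symm.le.trans (acc_mono O ?_ _)))))
    omega
  refine (le_acc_offline_of_computes (track_injective 1)
    (notMem_range_track (r := rNil) (by norm_num) (by norm_num)) O v _ hR _ _
    hnil₁ setup_recover h₂).trans ?_
  refine (acc_seq O _ _ _ _ _).symm.le.trans ((Exec.copy.le_acc _ _).trans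
    ((acc_seq O _ _ _ _ _).symm.le.trans (acc_mono O ?_ _)))
  omega

end Real

/-! ### Generators of small divergence -/

theorem outDist_apply_of_ne_nil (O : Oracle) (p : Prog) (xs : List Str) (t : ℕ) {z : Str}
    (hz : z ≠ []) : outDist O p xs t z = exec O p xs t (some z) := by
  classical
  rw [outDist, PMF.map_apply, tsum_eq_single (some z)]
  · simp
  · rintro (_ | y) hy
    · simp [hz]
    · have : z ≠ y := fun h => hy (by rw [h])
      simp [this]

/-- A generator of small divergence from the uniform distribution on the strings `smp x` avoids any
short list `xs` of arguments with large probability.  The inequality `log u ≤ u - 1` is applied to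
the arguments outside `xs`; for those in `xs` the logarithm is at least `-n`. -/
theorem le_sum_of_klDivergence_le {n l : ℕ} {smp : Str → Str}
    (hinj : Set.InjOn smp (bitStrings n)) (hl : ∀ x ∈ bitStrings n, smp x ∈ bitStrings l)
    {D' : PMF Str} {ε : ℝ} (hε : 0 ≤ ε)
    (hD : klDivergence l ((PMF.uniformOfFinset (bitStrings n) (bitStrings_nonempty n)).map smp) D'
      ≤ (ε : EReal)) (xs : List Str) :
    ENNReal.ofReal (1 - ε - xs.length * (n + 1) / 2 ^ n)
      ≤ ∑ x ∈ bitStrings n with x ∉ xs, D' (smp x) := by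
  classical
  set D := (PMF.uniformOfFinset (bitStrings n) (bitStrings_nonempty n)).map smp with hDdef
  have hDsmp (x) (hx : x ∈ bitStrings n) : D (smp x) = (2 ^ n : ℝ≥0∞)⁻¹ := by
    rw [hDdef, PMF.map_apply, tsum_eq_single x]
    · rw [if_pos rfl, PMF.uniformOfFinset_apply_of_mem _ hx, card_bitStrings]
      push_cast
      rfl
    · intro y hy
      by_cases hyn : y ∈ bitStrings n
      · rw [if_neg]
        exact fun h => hy (hinj hyn hx h.symm)
      · rw [PMF.uniformOfFinset_apply_of_notMem _ hyn, ite_self]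
  have hDzero (z) (hz : z ∉ (bitStrings n).image smp) : D z = 0 := by
    rw [hDdef, PMF.map_apply, ENNReal.tsum_eq_zero]
    intro y
    by_cases hyn : y ∈ bitStrings n
    · rw [if_neg]
      rintro rfl
      exact hz (Finset.mem_image_of_mem _ hyn)
    · rw [PMF.uniformOfFinset_apply_of_notMem _ hyn, ite_self]
  unfold klDivergence at hD
  split_ifs at hD with hac
  swap
  · simp at hD
  rw [EReal.coe_le_coe_iff] at hD
  have hsum : ∑ z ∈ bitStrings l, (D z).toReal * Real.logb 2 ((D z).toReal / (D' z).toReal)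
      = ∑ x ∈ bitStrings n, (2 ^ n : ℝ)⁻¹ *
        Real.logb 2 ((2 ^ n : ℝ)⁻¹ / (D' (smp x)).toReal) := by
    rw [← Finset.sum_subset (Finset.image_subset_iff.2 hl), Finset.sum_image hinj]
    · refine Finset.sum_congr rfl fun x hx => ?_
      rw [hDsmp x hx]
      simp
    · intro z _ hz
      rw [hDzero z hz]
      simp
  rw [hsum] at hD
  set F := (bitStrings n).filter fun x => x ∉ xs with hF
  have hpow : (0 : ℝ) < 2 ^ n := by positivity
  have hlog2 : 0 < Real.log 2 := Real.log_pos (by norm_num)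
  have hlog2' : Real.log 2 ≤ 1 := by
    have := Real.log_le_sub_one_of_pos (x := 2) (by norm_num)
    linarith
  have hterm (x) (hx : x ∈ bitStrings n) :
      (if x ∉ xs then (2 ^ n : ℝ)⁻¹ - (D' (smp x)).toReal else -(n * (2 ^ n : ℝ)⁻¹))
        ≤ Real.log 2 * ((2 ^ n : ℝ)⁻¹ *
          Real.logb 2 ((2 ^ n : ℝ)⁻¹ / (D' (smp x)).toReal)) := by
    set q := (D' (smp x)).toReal with hq
    have hq0 : 0 < q := by
      refine ENNReal.toReal_pos (fun h => ?_) (PMF.apply_ne_top _ _)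
      have := hac _ (hl x hx) h
      rw [hDsmp x hx] at this
      simp at this
    have hq1 : q ≤ 1 :=
      ENNReal.toReal_le_of_le_ofReal zero_le_one (by simpa using PMF.coe_le_one _ _)
    have hrw : Real.log 2 * ((2 ^ n : ℝ)⁻¹ * Real.logb 2 ((2 ^ n : ℝ)⁻¹ / q))
        = (2 ^ n : ℝ)⁻¹ * -Real.log (2 ^ n * q) := by
      rw [Real.logb, ← Real.log_inv]
      have : (2 ^ n : ℝ)⁻¹ / q = (2 ^ n * q)⁻¹ := by
        field_simp
      rw [this]
      field_simp
    rw [hrw]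
    split_ifs with hxs
    swap
    · have h := Real.log_le_sub_one_of_pos (x := 2 ^ n * q) (by positivity)
      calc (2 ^ n : ℝ)⁻¹ - q = (2 ^ n : ℝ)⁻¹ * -(2 ^ n * q - 1) := by
            field_simp
            ring
        _ ≤ _ := by gcongr
    · have h : Real.log (2 ^ n * q) ≤ n := by
        rw [Real.log_mul hpow.ne' hq0.ne', Real.log_pow]
        have h₁ := Real.log_nonpos hq0.le hq1
        have h₂ : (n : ℝ) * Real.log 2 ≤ n * 1 := by gcongr
        linarith
      calc -(n * (2 ^ n : ℝ)⁻¹) = (2 ^ n : ℝ)⁻¹ * -(n : ℝ) := by ring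
        _ ≤ _ := by gcongr
  have htot := Finset.sum_le_sum hterm
  rw [← Finset.mul_sum, Finset.sum_ite, Finset.sum_sub_distrib, Finset.sum_const,
    Finset.sum_const, nsmul_eq_mul, nsmul_eq_mul, ← hF] at htot
  have hcard : (F.card : ℝ) + ((bitStrings n).filter fun x => ¬x ∉ xs).card = 2 ^ n := by
    rw [hF]
    exact_mod_cast (Finset.card_filter_add_card_filter_not (fun x => x ∉ xs)).trans
      (card_bitStrings n)
  have hcard' : (((bitStrings n).filter fun x => ¬x ∉ xs).card : ℝ) ≤ xs.length := by
    have : ((bitStrings n).filter fun x => ¬x ∉ xs) ⊆ xs.toFinset := by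
      intro x hx
      simpa using (Finset.mem_filter.1 hx).2
    exact_mod_cast (Finset.card_le_card this).trans xs.toFinset_card_le
  set c : ℝ := (((bitStrings n).filter fun x => ¬x ∉ xs).card : ℝ) with hc
  have hε' : Real.log 2 * ∑ x ∈ bitStrings n, (2 ^ n : ℝ)⁻¹ *
      Real.logb 2 ((2 ^ n : ℝ)⁻¹ / (D' (smp x)).toReal) ≤ ε := by
    calc _ ≤ Real.log 2 * ε := by gcongr
      _ ≤ 1 * ε := by gcongr
      _ = ε := one_mul ε
  have hreal : 1 - ε - xs.length * (n + 1) / 2 ^ n ≤ ∑ x ∈ F, (D' (smp x)).toReal := by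
    have h₁ : (F.card : ℝ) * (2 ^ n : ℝ)⁻¹ = 1 - c * (2 ^ n : ℝ)⁻¹ := by
      rw [eq_sub_iff_add_eq, ← add_mul, hcard, mul_inv_cancel₀ hpow.ne']
    have h₂ : c * (n + 1) * (2 ^ n : ℝ)⁻¹ ≤ xs.length * (n + 1) / 2 ^ n := by
      rw [div_eq_mul_inv]
      gcongr
    rw [h₁] at htot
    linarith [htot.trans hε']
  rw [← ENNReal.toReal_sum fun x _ => PMF.apply_ne_top _ _] at hreal
  exact ENNReal.ofReal_le_of_le_toReal hreal

theorem tendsto_polynomial_div_two_pow (q : Polynomial ℕ) :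
    Filter.Tendsto (fun n : ℕ => ((q.eval n : ℕ) : ℝ) / 2 ^ n) Filter.atTop (nhds 0) := by
  induction q using Polynomial.induction_on' with
  | add p q hp hq => simpa [add_div] using hp.add hq
  | monomial k c =>
    have := (tendsto_pow_const_div_const_pow_of_one_lt k (one_lt_two (α := ℝ))).const_mul (c : ℝ)
    simpa [mul_div_assoc] using this

/-! ### The two games -/

section Games

variable {C : KeyedCollection} {n : ℕ} (hn : 1 ≤ n) {enc : Str → Str}
  {R E : Prog} {T₁ T₂ : ℕ}
  (hDom : ∀ P ∈ C.params n, C.Dom P = bitStrings n)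
  (hCod : ∀ P ∈ C.params n, ∀ y ∈ C.Cod P, (BIN y).length ≤ n)
  (hR : ∀ P ∈ C.params n, Computes R [P] (unary n) T₁)
  (hE : ∀ P ∈ C.params n, Computes E [P] (enc P) T₂)
include hn hDom hCod hR hE

theorem prob_idealGame_le (hCod2 : ∀ P ∈ C.params n, 2 ≤ (C.Cod P).card) (A G : Prog) (t : ℕ) :
    prob (C.idealGame (distinguisher R E A G) n t) {some [true]} ≤ 1 / 2 := by
  classical
  rw [prob, PMF.toOuterMeasure_apply_singleton]
  refine ENNReal.toReal_le_of_le_ofReal (by norm_num) ?_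
  rw [KeyedCollection.idealGame, apply_eq_expect, expect_bind]
  refine expect_le fun P hP => ?_
  have hX (x) : x ∈ C.Dom P ↔ x.length = n := by rw [hDom P hP, mem_bitStrings]
  have h := sum_acc_distinguisher_le hn hX (hCod P hP) (hCod2 P hP) A G (hR P hP) (hE P hP) t
  have : Nonempty {y // y ∈ C.Cod P} := (C.cod_nonempty P).to_subtype
  rw [expect_bind, KeyedCollection.randomFunction, expect_uniformOfFintype, ← Finset.mul_sum]
  simp only [← apply_eq_expect, exec_apply_accept]
  refine (mul_le_mul_right h _).trans (le_of_eq ?_)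
  rw [← mul_div_assoc, ENNReal.inv_mul_cancel (Nat.cast_ne_zero.2 Fintype.card_ne_zero) (by simp)]
  simp

theorem le_prob_realGame (hF : ∀ P ∈ C.params n, ∀ k ∈ C.Key P, ∀ x ∈ C.Dom P, C.F P k x ∈ C.Cod P)
    {m : ℕ} (hm : ∀ P ∈ C.params n, (enc P).length = m) {A G : Prog} {T : ℕ} {ε δ : ℝ}
    (hε : 0 ≤ ε) (hδ : δ ≤ 1)
    (hA : IsLearner klDivergence SAMPLE ε δ (2 * n + m) (C.conceptClass enc n) A G n T)
    {t : ℕ} (ht : T₁ + T₂ + (40 * n + 70) * T + T + T * (16 * n + 30) + 70 * n + 9 * m + 200 ≤ t) :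
    (1 - δ) * (1 - ε - T * (n + 1) / 2 ^ n)
      ≤ prob (C.realGame (distinguisher R E A G) n t) {some [true]} := by
  classical
  rw [prob, PMF.toOuterMeasure_apply_singleton]
  refine (ENNReal.ofReal_le_iff_le_toReal (PMF.apply_ne_top _ _)).1 ?_
  rw [KeyedCollection.realGame, apply_eq_expect, expect_bind]
  refine le_expect fun P hP => ?_
  rw [expect_bind]
  refine le_expect fun k hk => ?_
  rw [← apply_eq_expect, exec_apply_accept]
  replace hk : k ∈ C.Key P := by
    simpa [KeyedCollection.keyDist] using hk
  have ha (x) (hx : x ∈ bitStrings n) : MQ (C.Dom P) (fun x => C.F P k x) x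
      = PMF.pure (BIN (C.F P k x)) ∧ (BIN (C.F P k x)).length ≤ n := by
    rw [← hDom P hP] at hx
    exact ⟨by simp [MQ, hx], hCod P hP _ (hF P hP k hk x hx)⟩
  obtain ⟨-, hA⟩ := hA _ ⟨P, hP, k, hk, rfl⟩
  set good : Set Str := {h | IsApproxGenerator klDivergence ε (2 * n + m) (C.genDist enc n P k) G
    [unary n, h] T} with hgood
  have hlen (x) (hx : x ∈ bitStrings n) : C.gen enc n P k x ∈ bitStrings (2 * n + m) := by
    have hx' := mem_bitStrings.1 hx
    rw [mem_bitStrings, KeyedCollection.gen, List.length_append, List.length_append, hx', hm P hP,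
      BINn_length (ha x hx).2]
    omega
  have hinj : Set.InjOn (C.gen enc n P k) (bitStrings n) := by
    intro x hx y hy hxy
    simp only [KeyedCollection.gen, List.append_assoc] at hxy
    exact (List.append_inj hxy ((mem_bitStrings.1 hx).trans (mem_bitStrings.1 hy).symm)).1
  have key := le_acc_distinguisher hn ha A G (hR P hP) (hE P hP) T
    (ENNReal.ofReal (1 - ε - T * (n + 1) / 2 ^ n)) good fun h hh xs hxs => by
      refine le_trans (ENNReal.ofReal_le_ofReal ?_)
        ((le_sum_of_klDivergence_le hinj hlen hε hh.2.2 xs).trans_eq ?_)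
      · gcongr
      · refine Finset.sum_congr rfl fun x hx => ?_
        have hx' := mem_bitStrings.1 (Finset.mem_filter.1 hx).1
        rw [outDist_apply_of_ne_nil]
        · rfl
        · intro h
          have := congrArg List.length h
          simp [KeyedCollection.gen, hx'] at this
          omega
  rw [ENNReal.ofReal_mul (by linarith)]
  refine le_trans (mul_le_mul_left ?_ _) (key.trans (acc_mono _ ?_ _))
  · exact ENNReal.ofReal_le_of_le_toReal hA
  · rw [hm P hP]
    exact ht

end Games

end PACGen

theorem corollary1 (C : KeyedCollection) (hC : C.ClassicalSecure)
    (hDom : ∀ n : ℕ, 1 ≤ n → ∀ P ∈ C.params n, C.Dom P = bitStrings n)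
    (hCod : ∀ n : ℕ, 1 ≤ n → ∀ P ∈ C.params n, ∀ y ∈ C.Cod P, (BIN y).length ≤ n)
    (hCod2 : ∀ n : ℕ, 1 ≤ n → ∀ P ∈ C.params n, 2 ≤ (C.Cod P).card)
    (m : ℕ → ℕ) (enc : Str → Str) (henc : C.IsEfficientEncoding m enc) :
    ¬ LearnableInfinitelyOften klDivergence SAMPLE (fun n => 2 * n + m n)
      (fun n => C.conceptClass enc n) := by
  intro hlearn
  obtain ⟨A, G, t, hA⟩ := hlearn (1 / 8) (1 / 8) (by norm_num) (by norm_num) (by norm_num)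
  obtain ⟨R, qR, hR⟩ := hC.efficient.recover
  obtain ⟨E, qE, hE⟩ := henc.computable
  obtain ⟨qm, hqm⟩ := henc.poly
  -- a polynomial bound for the running time of the distinguisher
  set T : Polynomial ℕ := qR + qE + (40 * Polynomial.X + 70) * t + t
    + t * (16 * Polynomial.X + 30) + 70 * Polynomial.X + 9 * qm + 200 with hT
  have hsec := hC.secure (distinguisher R E A G) T 8 (by norm_num)
  have hsmall := (tendsto_polynomial_div_two_pow (t * (Polynomial.X + 1))).eventually_lt_const
    (show (0 : ℝ) < 1 / 8 by norm_num)
  obtain ⟨n, hAn, hsecn, hsmalln, hn⟩ :=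
    (hA.and_eventually (hsec.and (hsmall.and (Filter.eventually_ge_atTop 1)))).exists
  have hideal := prob_idealGame_le hn (hDom n hn) (hCod n hn) (hR n) (hE n) (hCod2 n hn) A G
    (T.eval n)
  have hreal := le_prob_realGame hn (hDom n hn) (hCod n hn) (hR n) (hE n)
    (hC.efficient.maps_to n) (henc.length_eq n) (by norm_num) (by norm_num) hAn (t := T.eval n) (by
      have := hqm n
      simp only [hT, Polynomial.eval_add, Polynomial.eval_mul, Polynomial.eval_X,
        Polynomial.eval_ofNat]
      omega)
  simp only [Polynomial.eval_mul, Polynomial.eval_add, Polynomial.eval_X, Polynomial.eval_one,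
    Nat.cast_mul, Nat.cast_add, Nat.cast_one] at hsmalln
  have h8 : ((Polynomial.eval n (8 : Polynomial ℕ) : ℕ) : ℝ) = 8 := by
    rw [Polynomial.eval_ofNat]
    norm_num
  rw [h8, abs_lt] at hsecn
  -- the advantage is at least `7 / 8 * (7 / 8 - 1 / 8) - 1 / 2`, which exceeds `1 / 8`
  linarith [hsecn.2]
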